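/- Let $E,J,R,Q\in\mathbb R^{n\times n}$ and $B\in\mathbb R^{n\times m}$ satisfy $J=-J^\top$, $R=R^\top\ge 0$ and $Q^\top E=E^\top Q\ge 0$, and let the descriptor system $$\tfrac{d}{dt}Ex=(J-R)Qx+Bu,\qquad y=B^\top Qx$$ be regular (i.e. $\mu E-(J-R)Q$ is invertible for some $\mu\in\mathbb C\setminus\{0\}$) with differentiation index at most one (i.e. the ascent of $(\mu E-(J-R)Q)^{-1}E$ is at most one). Let $\mathbb U\subset\mathbb R^m$ be convex and compact with $0\in\operatorname{int}\mathbb U$, and let $\Psi\subset\operatorname{im}E$ be closed. A solution on $[0,T]$ is a pair of integrable functions $(x,u)$ on $[0,T]$ such that $Ex\in W^{1,1}(0,T;\mathbb R^n)$ and the differential equation holds almost everywhere; $Ex(0)$ and $Ex(T)$ are the values of the continuous representative of $Ex$. For $w^0\in\operatorname{im}E$ and $T>0$ consider the optimal control problem $$\min_{u\in L^1(0,T;\mathbb U)}\int_0^T u(t)^\top y(t)\,dt\quad\text{s.t.}\quad \tfrac{d}{dt}Ex=(J-R)Qx+Bu,\ \ y=B^\top Qx,\ \ Ex(0)=w^0,\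 \ Ex(T)\in\Psi. \qquad (\mathrm{OCP})$$ For $w\in\operatorname{im}E$ let $\mathcal C(w)\subset\operatorname{im}E$ be the set consisting of $w$ and of all $w^0\in \operatorname{im}E$ for which there are $t>0$ and a solution $(x,u)$ on $[0,t]$ with $u\in L^1(0,t;\mathbb U)$, $Ex(0)=w^0$ and $Ex(t)=w$; let $\mathcal C(\Psi)=\bigcup_{w\in\Psi}\mathcal C(w)$. A steady state is a pair $(w,u)\in\operatorname{im}E\times\mathbb U$ for which there is $x\in\mathbb R^n$ with $Ex=w$ and $(J-R)Qx+Bu=0$; it is optimal if it minimizes $u^\top B^\top Qx$ among all steady states. Let $(\bar w,\bar u)\in\operatorname{im}E\times\operatorname{int}\mathbb U$ be an optimal steady state with $\bar w\in\mathcal C(\Psi)$. Then (OCP) has the state integral turnpike property on $\mathcal C(\bar w)$ with respect to $\ker(RQ)$. That is, $\mathcal C(\bar w)\subset\mathcal C(\Psi)$, and there exist continuous functions $F,T_0:\mathcal C(\bar w)\to[0,\infty)$ such that for every $w^0\in\mathcal C(\bar w)$, every $T>T_0(w^0)$ and every optimal pair $(x^\star,u^\star)$ of (OCP) with horizon $T$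 and initial datum $Ex^\star(0)=w^0$, the function $t\mapsto\operatorname{dist}^2(x^\star(t),\ker(RQ))$ is integrable on $[0,T]$ and $$\int_0^T\operatorname{dist}^2\big(x^\star(t),\ker(RQ)\big)\,dt\le F(w^0).$$ -/

import Mathlib

open MeasureTheory Set
open scoped Matrix

noncomputable section

/-! ### Matrix pencils: regularity and differentiation index -/

/-- The complex matrix `μ E - A`. -/
def pencilAt {n : ℕ} (E A : Matrix (Fin n) (Fin n) ℝ) (μ : ℂ) : Matrix (Fin n) (Fin n) ℂ :=
  μ • E.map (algebraMap ℝ ℂ) - A.map (algebraMap ℝ ℂ)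

/-- The pencil `s E - A` is regular: `μ E - A` is invertible for some `μ ≠ 0`. -/
def IsRegularPencil {n : ℕ} (E A : Matrix (Fin n) (Fin n) ℝ) : Prop :=
  ∃ μ : ℂ, μ ≠ 0 ∧ IsUnit (pencilAt E A μ)

/-- The matrix `(μ E - A)⁻¹ E`. -/
def pencilResolvent {n : ℕ} (E A : Matrix (Fin n) (Fin n) ℝ) (μ : ℂ) :
    Matrix (Fin n) (Fin n) ℂ :=
  (pencilAt E A μ)⁻¹ * E.map (algebraMap ℝ ℂ)

/-- The differentiation index of a regular DAE `d/dt (E x) = A x + b`: the ascent of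
`T = (μ E - A)⁻¹ E`, i.e. the least `k` with `ker T ^ k = ker T ^ (k + 1)`, where `μ ≠ 0` is such
that `μ E - A` is invertible (the ascent does not depend on the choice of `μ`). -/
def differentiationIndex {n : ℕ} (E A : Matrix (Fin n) (Fin n) ℝ) : ℕ :=
  sInf {k : ℕ | ∃ μ : ℂ, μ ≠ 0 ∧ IsUnit (pencilAt E A μ) ∧
    LinearMap.ker ((pencilResolvent E A μ) ^ k).mulVecLin =
      LinearMap.ker ((pencilResolvent E A μ) ^ (k + 1)).mulVecLin}

/-! ### Linear descriptor systems `d/dt (E x) = A x + B u` -/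

/-- The image of `E`, as a subspace of Euclidean space. -/
def imE {n : ℕ} (E : Matrix (Fin n) (Fin n) ℝ) : Submodule ℝ (EuclideanSpace ℝ (Fin n)) :=
  LinearMap.range E.toEuclideanLin

/-- `(u, x)` is a pair of integrable functions on `[0, T]` with `E x ∈ W^{1,1}(0, T)` that satisfies
`d/dt (E x) = A x + B u` almost everywhere on `(0, T)`; the function `w` is the absolutely continuous
representative of `E x`, so that the values `(E x)(0)` and `(E x)(T)` are `w 0` and `w T`. -/
structure IsDAESolution {n m : ℕ} (E A : Matrix (Fin n) (Fin n) ℝ) (B : Matrix (Fin n) (Fin m) ℝ)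
    (T : ℝ) (u : ℝ → EuclideanSpace ℝ (Fin m)) (x w : ℝ → EuclideanSpace ℝ (Fin n)) : Prop where
  integrable_control : IntervalIntegrable u volume 0 T
  integrable_state : IntervalIntegrable x volume 0 T
  absolutelyContinuous : AbsolutelyContinuousOnInterval w 0 T
  representative : ∀ᵐ t ∂volume.restrict (Ioo 0 T), w t = E.toEuclideanLin (x t)
  dynamics : ∀ᵐ t ∂volume.restrict (Ioo 0 T),
    HasDerivAt w (A.toEuclideanLin (x t) + B.toEuclideanLin (u t)) t

/-- `(x, u)` is a solution on `[0, T]` with control `u ∈ L¹(0, T; U)`, with `(E x)(0) = w₀`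
and with `(E x)(T) ∈ Ψ`. -/
def IsAdmissiblePair {n m : ℕ} (E A : Matrix (Fin n) (Fin n) ℝ) (B : Matrix (Fin n) (Fin m) ℝ)
    (U : Set (EuclideanSpace ℝ (Fin m))) (T : ℝ) (w₀ : EuclideanSpace ℝ (Fin n))
    (Ψ : Set (EuclideanSpace ℝ (Fin n)))
    (x : ℝ → EuclideanSpace ℝ (Fin n)) (u : ℝ → EuclideanSpace ℝ (Fin m)) : Prop :=
  (∀ᵐ t ∂volume.restrict (Ioo 0 T), u t ∈ U) ∧
    ∃ w : ℝ → EuclideanSpace ℝ (Fin n), IsDAESolution E A B T u x w ∧ w 0 = w₀ ∧ w T ∈ Ψ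

/-- The set of `w₀ ∈ im E` from which `w` is reachable at time `t`. -/
def controllableAt {n m : ℕ} (E A : Matrix (Fin n) (Fin n) ℝ) (B : Matrix (Fin n) (Fin m) ℝ)
    (U : Set (EuclideanSpace ℝ (Fin m))) (t : ℝ) (w : EuclideanSpace ℝ (Fin n)) :
    Set (EuclideanSpace ℝ (Fin n)) :=
  {w₀ | w₀ ∈ imE E ∧ ((t = 0 ∧ w₀ = w) ∨ (0 < t ∧ ∃ x u, IsAdmissiblePair E A B U t w₀ {w} x u))}

/-- `C(w)`: the set of `w₀ ∈ im E` that can be steered to `w` in some time `t ≥ 0`. -/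
def controllableTo {n m : ℕ} (E A : Matrix (Fin n) (Fin n) ℝ) (B : Matrix (Fin n) (Fin m) ℝ)
    (U : Set (EuclideanSpace ℝ (Fin m))) (w : EuclideanSpace ℝ (Fin n)) :
    Set (EuclideanSpace ℝ (Fin n)) :=
  ⋃ t ∈ Ici (0 : ℝ), controllableAt E A B U t w

/-- `C(Ψ)`: the set of `w₀ ∈ im E` that can be steered into `Ψ`. -/
def controllableToSet {n m : ℕ} (E A : Matrix (Fin n) (Fin n) ℝ) (B : Matrix (Fin n) (Fin m) ℝ)
    (U : Set (EuclideanSpace ℝ (Fin m))) (Ψ : Set (EuclideanSpace ℝ (Fin n))) :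
    Set (EuclideanSpace ℝ (Fin n)) :=
  ⋃ w ∈ Ψ, controllableTo E A B U w

/-! ### Port-Hamiltonian descriptor systems and minimal energy supply -/

/-- The data of a linear port-Hamiltonian descriptor system
`d/dt (E x) = (J - R) Q x + B u`, `y = Bᵀ Q x`. -/
structure PHDescriptorSystem (n m : ℕ) where
  E : Matrix (Fin n) (Fin n) ℝ
  J : Matrix (Fin n) (Fin n) ℝ
  R : Matrix (Fin n) (Fin n) ℝ
  Q : Matrix (Fin n) (Fin n) ℝ
  B : Matrix (Fin n) (Fin m) ℝ
  J_skew : J = -Jᵀ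
  R_symm : R = Rᵀ
  R_nonneg : R.PosSemidef
  QE_symm : Qᵀ * E = Eᵀ * Q
  QE_nonneg : (Qᵀ * E).PosSemidef

namespace PHDescriptorSystem

variable {n m : ℕ}

/-- The system matrix `A = (J - R) Q`. -/
def A (S : PHDescriptorSystem n m) : Matrix (Fin n) (Fin n) ℝ := (S.J - S.R) * S.Q

/-- The output `y = Bᵀ Q x`. -/
def output (S : PHDescriptorSystem n m) (x : EuclideanSpace ℝ (Fin n)) :
    EuclideanSpace ℝ (Fin m) :=
  (S.Bᵀ * S.Q).toEuclideanLin x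

/-- The supplied energy `∫₀ᵀ uᵀ y dt`. -/
def suppliedEnergy (S : PHDescriptorSystem n m) (T : ℝ)
    (x : ℝ → EuclideanSpace ℝ (Fin n)) (u : ℝ → EuclideanSpace ℝ (Fin m)) : ℝ :=
  ∫ t in (0 : ℝ)..T, inner ℝ (u t) (S.output (x t))

/-- `(x, u)` is an optimal pair of the problem of minimizing the supplied energy over the controls in
`L¹(0, T; U)` that steer `w₀` into `Ψ` at time `T`. -/
def IsOptimalPair (S : PHDescriptorSystem n m) (U : Set (EuclideanSpace ℝ (Fin m)))
    (Ψ : Set (EuclideanSpace ℝ (Fin n))) (T : ℝ) (w₀ : EuclideanSpace ℝ (Fin n))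
    (x : ℝ → EuclideanSpace ℝ (Fin n)) (u : ℝ → EuclideanSpace ℝ (Fin m)) : Prop :=
  IsAdmissiblePair S.E S.A S.B U T w₀ Ψ x u ∧
    ∀ x' u', IsAdmissiblePair S.E S.A S.B U T w₀ Ψ x' u' →
      S.suppliedEnergy T x u ≤ S.suppliedEnergy T x' u'

/-- `(w, u)` with `u ∈ U` is a steady state, `x` being the corresponding state with `E x = w`. -/
def IsSteadyStateWith (S : PHDescriptorSystem n m) (U : Set (EuclideanSpace ℝ (Fin m)))
    (w : EuclideanSpace ℝ (Fin n)) (u : EuclideanSpace ℝ (Fin m))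
    (x : EuclideanSpace ℝ (Fin n)) : Prop :=
  u ∈ U ∧ S.E.toEuclideanLin x = w ∧ S.A.toEuclideanLin x + S.B.toEuclideanLin u = 0

/-- `(w, u)` is an optimal steady state: it minimizes `uᵀ y` among all steady states. -/
def IsOptimalSteadyState (S : PHDescriptorSystem n m) (U : Set (EuclideanSpace ℝ (Fin m)))
    (w : EuclideanSpace ℝ (Fin n)) (u : EuclideanSpace ℝ (Fin m)) : Prop :=
  ∃ x, S.IsSteadyStateWith U w u x ∧
    ∀ w' u' x', S.IsSteadyStateWith U w' u' x' →
      inner ℝ u (S.output x) ≤ inner ℝ u' (S.output x')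

/-- The state integral turnpike property of the minimal energy supply problem on a set
`Stp ⊆ C(Ψ)` with respect to a subspace `V`. Functions `Stp → [0, ∞)` are represented by functions
on the whole space, of which only the values on `Stp` matter. -/
def HasStateIntegralTurnpike (S : PHDescriptorSystem n m) (U : Set (EuclideanSpace ℝ (Fin m)))
    (Ψ : Set (EuclideanSpace ℝ (Fin n))) (Stp : Set (EuclideanSpace ℝ (Fin n)))
    (V : Submodule ℝ (EuclideanSpace ℝ (Fin n))) : Prop :=
  Stp ⊆ controllableToSet S.E S.A S.B U Ψ ∧
    ∃ F T₀ : EuclideanSpace ℝ (Fin n) → ℝ,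
      ContinuousOn F Stp ∧ ContinuousOn T₀ Stp ∧ (∀ w ∈ Stp, 0 ≤ F w ∧ 0 ≤ T₀ w) ∧
      ∀ w₀ ∈ Stp, ∀ T : ℝ, T₀ w₀ < T → ∀ x u, S.IsOptimalPair U Ψ T w₀ x u →
        IntervalIntegrable (fun t => Metric.infDist (x t) V ^ 2) volume 0 T ∧
          ∫ t in (0 : ℝ)..T, Metric.infDist (x t) V ^ 2 ≤ F w₀

end PHDescriptorSystem

end

/-! The argument compares an energy balance with an explicit competitor. With the Hamiltonian `w ↦
⟪Q (G w), w⟫ / 2` on `im E`, every solution satisfies: stored energy at `T` = stored energy at `0` +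
supplied energy − `∫ ‖C x‖²`, where `ker C = ker (R Q)`. Since the stored energy is nonnegative and
the distance to `ker C` is at most `c ‖C x‖`, it remains to bound the optimal supplied energy
independently of `T` (`IsOptimalPair.integral_infDist_sq_le`).

The competitor steers `w₀` to the optimal steady state, rests there, and leaves for `Ψ` at the end.
Resting costs nothing, because the optimal steady supply is at most that of the zero steady state
(`IsOptimalPair.suppliedEnergy_le`).

The delicate point is that time and cost of reaching the steady state can be bounded continuously in
`w₀`. Index at most one makes the state a linear function of `E x` and `u`, so the uncontrolled
system is an ODE on `im E`. For two nearby initial values that reach the steady state, the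
difference lies in the space of null-controllable states, which the uncontrolled flow preserves.
Reusing the control of the first value leaves a small null-controllable error, removed by a small
control added to the steady one; this is where the steady control being interior enters
(`exists_nhds_canSteer`). The resulting local bounds are glued to a continuous one in
`exists_continuousOn_steering_bound`. -/

noncomputable section

/-! ### Absolutely continuous functions and indefinite integrals -/

section AbsolutelyContinuous

variable {X Y : Type*} [PseudoMetricSpace X] [PseudoMetricSpace Y]

theorem AbsolutelyContinuousOnInterval.of_dist_le {f : ℝ → X} {g : ℝ → Y} {a b C : ℝ}
    (hg : AbsolutelyContinuousOnInterval g a b)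
    (h : ∀ s ∈ uIcc a b, ∀ t ∈ uIcc a b, dist (f s) (f t) ≤ C * dist (g s) (g t)) :
    AbsolutelyContinuousOnInterval f a b := by
  rw [absolutelyContinuousOnInterval_iff] at hg ⊢
  intro ε hε
  obtain ⟨δ, hδ, H⟩ := hg (ε / (|C| + 1)) (by positivity)
  refine ⟨δ, hδ, fun I hI hlen ↦ ?_⟩
  have hmem : ∀ i ∈ Finset.range I.1, (I.2 i).1 ∈ uIcc a b ∧ (I.2 i).2 ∈ uIcc a b := hI.1
  calc ∑ i ∈ Finset.range I.1, dist (f (I.2 i).1) (f (I.2 i).2)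
      ≤ ∑ i ∈ Finset.range I.1, (|C| + 1) * dist (g (I.2 i).1) (g (I.2 i).2) := by
        refine Finset.sum_le_sum fun i hi ↦ (h _ (hmem i hi).1 _ (hmem i hi).2).trans ?_
        gcongr
        linarith [le_abs_self C]
    _ = (|C| + 1) * ∑ i ∈ Finset.range I.1, dist (g (I.2 i).1) (g (I.2 i).2) := by
        rw [Finset.mul_sum]
    _ < (|C| + 1) * (ε / (|C| + 1)) := by
        gcongr
        exact H I hI hlen
    _ = ε := by field_simp

variable {F : Type*} [NormedAddCommGroup F] [NormedSpace ℝ F]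

theorem IntervalIntegrable.absolutelyContinuousOnInterval_vector_integral {f : ℝ → F} {a b : ℝ}
    (h : IntervalIntegrable f volume a b) :
    AbsolutelyContinuousOnInterval (fun t ↦ ∫ s in a..t, f s) a b := by
  refine (h.norm.absolutelyContinuousOnInterval_intervalIntegral left_mem_uIcc).of_dist_le
    (C := 1) fun s hs t ht ↦ ?_
  have hi : ∀ r ∈ uIcc a b, IntervalIntegrable f volume a r := fun r hr ↦
    h.mono_set (uIcc_subset_uIcc_left hr)
  rw [dist_eq_norm, dist_eq_norm, intervalIntegral.integral_interval_sub_left (hi s hs) (hi t ht),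
    intervalIntegral.integral_interval_sub_left (hi s hs).norm (hi t ht).norm, one_mul,
    Real.norm_eq_abs]
  exact intervalIntegral.norm_integral_le_abs_integral_norm

/-- The difference of `w` and the primitive of `f` is absolutely continuous with derivative zero
almost everywhere, hence constant. -/
theorem AbsolutelyContinuousOnInterval.eq_add_integral [CompleteSpace F] {w f : ℝ → F} {a b : ℝ}
    (hab : a ≤ b) (hw : AbsolutelyContinuousOnInterval w a b)
    (hf : IntervalIntegrable f volume a b)
    (hd : ∀ᵐ t, t ∈ Ioo a b → HasDerivAt w (f t) t) {t : ℝ} (ht : t ∈ Icc a b) :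
    w t = w a + ∫ s in a..t, f s := by
  have hac := hw.sub hf.absolutelyContinuousOnInterval_vector_integral
  obtain ⟨c, hc⟩ := hac.const_of_ae_hasDerivAt_zero (by
    have h₁ : ∀ᵐ x : ℝ, x ≠ a := by simp [ae_iff, measure_singleton]
    have h₂ : ∀ᵐ x : ℝ, x ≠ b := by simp [ae_iff, measure_singleton]
    filter_upwards [hd, hf.ae_hasDerivAt_integral, h₁, h₂] with s hs hs' ha hb hmem
    have hm := hmem
    rw [uIcc_of_le hab] at hm
    have := (hs ⟨lt_of_le_of_ne hm.1 (Ne.symm ha), lt_of_le_of_ne hm.2 hb⟩).sub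
      (hs' hmem a left_mem_uIcc)
    rwa [sub_self] at this)
  have h1 := hc t (by rwa [uIcc_of_le hab])
  have h2 := hc a left_mem_uIcc
  simp only [Pi.sub_apply, intervalIntegral.integral_same, sub_zero] at h1 h2
  rw [h2, ← h1]
  abel

theorem hasDerivAt_of_eq_add_integral [CompleteSpace F] {w f : ℝ → F} {a b : ℝ} (hab : a ≤ b)
    (hf : IntervalIntegrable f volume a b) (c : F)
    (hw : ∀ t ∈ Icc a b, w t = c + ∫ s in a..t, f s) :
    ∀ᵐ t, t ∈ Ioo a b → HasDerivAt w (f t) t := by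
  filter_upwards [hf.ae_hasDerivAt_integral] with t ht hmem
  have := (ht (by rw [uIcc_of_le hab]; exact Ioo_subset_Icc_self hmem) a left_mem_uIcc).const_add c
  refine this.congr_of_eventuallyEq ?_
  filter_upwards [Ioo_mem_nhds hmem.1 hmem.2] with s hs using hw s (Ioo_subset_Icc_self hs)

theorem absolutelyContinuousOnInterval_of_eq_add_integral {w f : ℝ → F} {a b : ℝ} (hab : a ≤ b)
    (hf : IntervalIntegrable f volume a b) (c : F)
    (hw : ∀ t ∈ Icc a b, w t = c + ∫ s in a..t, f s) :
    AbsolutelyContinuousOnInterval w a b := by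
  refine hf.absolutelyContinuousOnInterval_vector_integral.of_dist_le (C := 1) fun s hs t ht ↦ ?_
  rw [uIcc_of_le hab] at hs ht
  rw [hw s hs, hw t ht, dist_add_left, one_mul]

end AbsolutelyContinuous

/-! ### Concatenation of functions on the half-line -/

/-- Follow `f` up to time `s`, and the shifted function `g` from then on. -/
def concatAt {X : Type*} (s : ℝ) (f g : ℝ → X) : ℝ → X := fun t ↦ if t < s then f t else g (t - s)

section Concat

variable {X Y : Type*}

theorem concatAt_of_lt {s t : ℝ} (f g : ℝ → X) (h : t < s) : concatAt s f g t = f t := if_pos h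

theorem concatAt_of_le {s t : ℝ} (f g : ℝ → X) (h : s ≤ t) : concatAt s f g t = g (t - s) :=
  if_neg h.not_gt

theorem concatAt_of_le_of_eq {s t : ℝ} {f g : ℝ → X} (hfg : f s = g 0) (h : t ≤ s) :
    concatAt s f g t = f t := by
  rcases h.lt_or_eq with h | rfl
  · exact concatAt_of_lt f g h
  · rw [concatAt_of_le f g le_rfl, sub_self, hfg]

theorem apply_concatAt₂ {Z : Type*} (φ : X → Y → Z) (s : ℝ) (f g : ℝ → X) (f' g' : ℝ → Y) :
    (fun t ↦ φ (concatAt s f g t) (concatAt s f' g' t)) =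
      concatAt s (fun t ↦ φ (f t) (f' t)) (fun t ↦ φ (g t) (g' t)) := by
  ext t
  unfold concatAt
  split_ifs <;> rfl

/-- The shift by `s` preserves Lebesgue measure, and the junction time `s` is a null set. -/
theorem ae_concatAt {p q : ℝ → Prop} {s t : ℝ}
    (hp : ∀ᵐ τ, τ ∈ Ioo 0 s → p τ) (hq : ∀ᵐ τ, τ ∈ Ioo 0 t → q τ) :
    ∀ᵐ τ, τ ∈ Ioo 0 (s + t) → (τ < s ∧ p τ) ∨ (s < τ ∧ q (τ - s)) := by
  have hq' := (measurePreserving_sub_right (volume : Measure ℝ) s).quasiMeasurePreserving.ae hq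
  have hs : ∀ᵐ τ : ℝ, τ ≠ s := by simp [ae_iff, measure_singleton]
  filter_upwards [hp, hq', hs] with τ h1 h2 h3 h4
  rcases lt_or_gt_of_ne h3 with h | h
  · exact Or.inl ⟨h, h1 ⟨h4.1, h⟩⟩
  · exact Or.inr ⟨h, h2 ⟨by linarith, by linarith [h4.2]⟩⟩

variable [NormedAddCommGroup X] {f g : ℝ → X} {s t : ℝ}

theorem intervalIntegrable_concatAt_left (hs : 0 ≤ s) (hf : IntervalIntegrable f volume 0 s) :
    IntervalIntegrable (concatAt s f g) volume 0 s := by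
  refine hf.congr_uIoo fun τ hτ ↦ ?_
  rw [uIoo_of_le hs] at hτ
  exact (concatAt_of_lt f g hτ.2).symm

theorem intervalIntegrable_concatAt_right (ht : 0 ≤ t) (hg : IntervalIntegrable g volume 0 t) :
    IntervalIntegrable (concatAt s f g) volume s (s + t) := by
  have := hg.comp_sub_right s
  rw [zero_add, add_comm] at this
  refine this.congr_uIoo fun τ hτ ↦ ?_
  rw [uIoo_of_le (by linarith)] at hτ
  exact (concatAt_of_le f g hτ.1.le).symm

theorem intervalIntegrable_concatAt (hs : 0 ≤ s) (ht : 0 ≤ t)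
    (hf : IntervalIntegrable f volume 0 s) (hg : IntervalIntegrable g volume 0 t) :
    IntervalIntegrable (concatAt s f g) volume 0 (s + t) :=
  (intervalIntegrable_concatAt_left hs hf).trans (intervalIntegrable_concatAt_right ht hg)

variable [NormedSpace ℝ X]

theorem integral_concatAt_of_le {τ : ℝ} (h0 : 0 ≤ τ) (hτ : τ ≤ s) :
    ∫ r in (0 : ℝ)..τ, concatAt s f g r = ∫ r in (0 : ℝ)..τ, f r :=
  intervalIntegral.integral_congr_Ioo_of_le h0 fun _ hr ↦ concatAt_of_lt f g (hr.2.trans_le hτ)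

theorem integral_concatAt_add (hs : 0 ≤ s) (ht : 0 ≤ t)
    (hf : IntervalIntegrable f volume 0 s) (hg : IntervalIntegrable g volume 0 t) :
    ∫ r in (0 : ℝ)..(s + t), concatAt s f g r =
      (∫ r in (0 : ℝ)..s, f r) + ∫ r in (0 : ℝ)..t, g r := by
  rw [← intervalIntegral.integral_add_adjacent_intervals (intervalIntegrable_concatAt_left hs hf)
    (intervalIntegrable_concatAt_right ht hg), integral_concatAt_of_le hs le_rfl]
  congr 1
  have h1 : ∫ r in s..(s + t), concatAt s f g r = ∫ r in s..(s + t), g (r - s) :=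
    intervalIntegral.integral_congr_Ioo_of_le (by linarith) fun r hr ↦ concatAt_of_le f g hr.1.le
  rw [h1, intervalIntegral.integral_comp_sub_right]
  simp

end Concat

/-! ### Solutions of descriptor systems in integral form -/

section IntegralSolution

variable {X Y : Type*} [NormedAddCommGroup X] [NormedSpace ℝ X] [NormedAddCommGroup Y]
  [NormedSpace ℝ Y]

/-- Solutions of `d/dt (E x) = A x + B u` on `[0, T]` in integrated form. -/
structure IsIntegralSolution (E A : X →L[ℝ] X) (B : Y →L[ℝ] X) (T : ℝ)
    (u : ℝ → Y) (x w : ℝ → X) : Prop where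
  control : IntervalIntegrable u volume 0 T
  state : IntervalIntegrable x volume 0 T
  representative : ∀ᵐ t, t ∈ Ioo 0 T → w t = E (x t)
  integral : ∀ t ∈ Icc 0 T, w t = w 0 + ∫ s in (0 : ℝ)..t, (A (x s) + B (u s))

theorem ContinuousLinearMap.comp_intervalIntegrable {x : ℝ → X} {a b : ℝ} (L : X →L[ℝ] Y)
    (hx : IntervalIntegrable x volume a b) : IntervalIntegrable (fun t ↦ L (x t)) volume a b :=
  ⟨L.integrable_comp hx.1, L.integrable_comp hx.2⟩

namespace IsIntegralSolution

variable {E A : X →L[ℝ] X} {B : Y →L[ℝ] X} {T : ℝ} {u u' : ℝ → Y} {x w x' w' : ℝ → X}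

theorem intervalIntegrable (h : IsIntegralSolution E A B T u x w) :
    IntervalIntegrable (fun s ↦ A (x s) + B (u s)) volume 0 T :=
  (A.comp_intervalIntegrable h.state).add (B.comp_intervalIntegrable h.control)

theorem intervalIntegrable_of_mem (h : IsIntegralSolution E A B T u x w) {t : ℝ}
    (ht : t ∈ Icc 0 T) : IntervalIntegrable (fun s ↦ A (x s) + B (u s)) volume 0 t := by
  refine h.intervalIntegrable.mono_set (uIcc_subset_uIcc_left ?_)
  rwa [uIcc_of_le (ht.1.trans ht.2)]

theorem add (h : IsIntegralSolution E A B T u x w) (h' : IsIntegralSolution E A B T u' x' w') :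
    IsIntegralSolution E A B T (u + u') (x + x') (w + w') where
  control := h.control.add h'.control
  state := h.state.add h'.state
  representative := by
    filter_upwards [h.representative, h'.representative] with t h1 h2 h3
    simp [h1 h3, h2 h3]
  integral t ht := by
    have : (fun s ↦ A ((x + x') s) + B ((u + u') s)) =
        fun s ↦ (A (x s) + B (u s)) + (A (x' s) + B (u' s)) := by
      ext s
      simp only [Pi.add_apply, map_add]
      abel
    rw [this, intervalIntegral.integral_add (h.intervalIntegrable_of_mem ht)
      (h'.intervalIntegrable_of_mem ht), Pi.add_apply, Pi.add_apply, h.integral t ht,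
      h'.integral t ht]
    abel

theorem smul (c : ℝ) (h : IsIntegralSolution E A B T u x w) :
    IsIntegralSolution E A B T (c • u) (c • x) (c • w) where
  control := h.control.smul c
  state := h.state.smul c
  representative := by
    filter_upwards [h.representative] with t h1 h3
    simp [h1 h3]
  integral t ht := by
    have : (fun s ↦ A ((c • x) s) + B ((c • u) s)) = fun s ↦ c • (A (x s) + B (u s)) := by
      ext s
      simp
    rw [this, intervalIntegral.integral_smul, Pi.smul_apply, Pi.smul_apply, h.integral t ht,
      smul_add]

theorem concat {s t : ℝ} (hs : 0 ≤ s) (ht : 0 ≤ t) (h : IsIntegralSolution E A B s u x w)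
    (h' : IsIntegralSolution E A B t u' x' w') (hw : w s = w' 0) :
    IsIntegralSolution E A B (s + t) (concatAt s u u') (concatAt s x x') (concatAt s w w') where
  control := intervalIntegrable_concatAt hs ht h.control h'.control
  state := intervalIntegrable_concatAt hs ht h.state h'.state
  representative := by
    filter_upwards [ae_concatAt h.representative h'.representative] with τ hτ hmem
    rcases hτ hmem with ⟨h1, h2⟩ | ⟨h1, h2⟩
    · rw [concatAt_of_lt _ _ h1, concatAt_of_lt _ _ h1, h2]
    · rw [concatAt_of_le _ _ h1.le, concatAt_of_le _ _ h1.le, h2]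
  integral τ hτ := by
    rw [apply_concatAt₂ (fun a b ↦ A a + B b), concatAt_of_le_of_eq hw hs]
    rcases le_or_gt τ s with hle | hlt
    · rw [concatAt_of_le_of_eq hw hle, integral_concatAt_of_le hτ.1 hle, h.integral τ ⟨hτ.1, hle⟩]
    · have hmem : τ - s ∈ Icc 0 t := ⟨by linarith, by linarith [hτ.2]⟩
      obtain ⟨r, rfl⟩ : ∃ r, τ = s + r := ⟨τ - s, by ring⟩
      rw [add_sub_cancel_left] at hmem
      rw [concatAt_of_le _ _ hlt.le, integral_concatAt_add hs hmem.1 h.intervalIntegrable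
        (h'.intervalIntegrable_of_mem hmem), add_sub_cancel_left, h'.integral r hmem, ← hw,
        h.integral s ⟨hs, le_rfl⟩, add_assoc]

theorem const (T : ℝ) {x₀ : X} {u₀ : Y} (h : A x₀ + B u₀ = 0) :
    IsIntegralSolution E A B T (fun _ ↦ u₀) (fun _ ↦ x₀) (fun _ ↦ E x₀) where
  control := intervalIntegrable_const
  state := intervalIntegrable_const
  representative := by simp
  integral t ht := by simp [h]

theorem of_hasDerivAt [CompleteSpace X] (T : ℝ) (hx : Continuous x) (hu : Continuous u)
    (h : ∀ t, w t = E (x t)) (hd : ∀ t, HasDerivAt w (A (x t) + B (u t)) t) :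
    IsIntegralSolution E A B T u x w where
  control := hu.intervalIntegrable _ _
  state := hx.intervalIntegrable _ _
  representative := ae_of_all _ fun t _ ↦ h t
  integral t ht := by
    rw [intervalIntegral.integral_eq_sub_of_hasDerivAt (fun s _ ↦ hd s)
      (Continuous.intervalIntegrable (by fun_prop) _ _)]
    abel

theorem ae_hasDerivAt [CompleteSpace X] (hT : 0 ≤ T) (h : IsIntegralSolution E A B T u x w) :
    ∀ᵐ t, t ∈ Ioo 0 T → HasDerivAt w (A (x t) + B (u t)) t :=
  hasDerivAt_of_eq_add_integral hT h.intervalIntegrable _ h.integral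

theorem absolutelyContinuous (hT : 0 ≤ T) (h : IsIntegralSolution E A B T u x w) :
    AbsolutelyContinuousOnInterval w 0 T :=
  absolutelyContinuousOnInterval_of_eq_add_integral hT h.intervalIntegrable _ h.integral

end IsIntegralSolution

end IntegralSolution

/-- The continuous linear map of Euclidean spaces given by a matrix. -/
def Matrix.euclideanCLM {n m : ℕ} (M : Matrix (Fin n) (Fin m) ℝ) :
    EuclideanSpace ℝ (Fin m) →L[ℝ] EuclideanSpace ℝ (Fin n) :=
  LinearMap.toContinuousLinearMap M.toEuclideanLin

theorem Matrix.euclideanCLM_apply {n m : ℕ} (M : Matrix (Fin n) (Fin m) ℝ)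
    (x : EuclideanSpace ℝ (Fin m)) : M.euclideanCLM x = M.toEuclideanLin x := rfl

/-- The integrated form needs no separate regularity of `w`, which makes sums and concatenations of
solutions easy to form. -/
theorem isDAESolution_iff_isIntegralSolution {n m : ℕ} {E A : Matrix (Fin n) (Fin n) ℝ}
    {B : Matrix (Fin n) (Fin m) ℝ} {T : ℝ} (hT : 0 ≤ T) {u : ℝ → EuclideanSpace ℝ (Fin m)}
    {x w : ℝ → EuclideanSpace ℝ (Fin n)} :
    IsDAESolution E A B T u x w ↔
      IsIntegralSolution E.euclideanCLM A.euclideanCLM B.euclideanCLM T u x w := by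
  constructor
  · intro h
    have hd := h.dynamics
    have hr := h.representative
    rw [ae_restrict_iff' measurableSet_Ioo] at hd hr
    simp only [← Matrix.euclideanCLM_apply] at hd hr
    refine ⟨h.integrable_control, h.integrable_state, hr, fun t ht ↦ ?_⟩
    have hi : IntervalIntegrable (fun s ↦ A.euclideanCLM (x s) + B.euclideanCLM (u s)) volume 0 T :=
      (A.euclideanCLM.comp_intervalIntegrable h.integrable_state).add
        (B.euclideanCLM.comp_intervalIntegrable h.integrable_control)
    exact h.absolutelyContinuous.eq_add_integral hT hi hd ht
  · intro h
    refine ⟨h.control, h.state, h.absolutelyContinuous hT, ?_, ?_⟩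
    · rw [ae_restrict_iff' measurableSet_Ioo]
      exact h.representative
    · rw [ae_restrict_iff' measurableSet_Ioo]
      simp only [← Matrix.euclideanCLM_apply]
      exact h.ae_hasDerivAt hT

/-! ### Transfers with bounded cost -/

section Transfer

variable {X Y : Type*} [NormedAddCommGroup X] [NormedSpace ℝ X] [NormedAddCommGroup Y]
  [NormedSpace ℝ Y]

/-- The system can be steered from `a` to `b` in time `T` with controls in `U` and with the integral
of the running cost `ℓ` at most `K`. -/
def CanSteer (E A : X →L[ℝ] X) (B : Y →L[ℝ] X) (ℓ : Y → X → ℝ) (U : Set Y) (T K : ℝ) (a b : X) :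
    Prop :=
  ∃ u x w, IsIntegralSolution E A B T u x w ∧ (∀ᵐ t, t ∈ Ioo 0 T → u t ∈ U) ∧ w 0 = a ∧ w T = b ∧
    IntervalIntegrable (fun t ↦ ℓ (u t) (x t)) volume 0 T ∧
    ∫ t in (0 : ℝ)..T, ℓ (u t) (x t) ≤ K

variable {E A : X →L[ℝ] X} {B : Y →L[ℝ] X} {ℓ : Y → X → ℝ} {U U' U'' : Set Y} {T T' K K' : ℝ}
  {a a' b b' c : X}

namespace CanSteer

theorem mono (h : CanSteer E A B ℓ U T K a b) (hU : U ⊆ U') (hK : K ≤ K') :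
    CanSteer E A B ℓ U' T K' a b := by
  obtain ⟨u, x, w, hs, hu, h0, h1, hi, hc⟩ := h
  exact ⟨u, x, w, hs, hu.mono fun t ht hm ↦ hU (ht hm), h0, h1, hi, hc.trans hK⟩

theorem trans (hT : 0 ≤ T) (hT' : 0 ≤ T') (h : CanSteer E A B ℓ U T K a b)
    (h' : CanSteer E A B ℓ U T' K' b c) : CanSteer E A B ℓ U (T + T') (K + K') a c := by
  obtain ⟨u, x, w, hs, hu, h0, h1, hi, hc⟩ := h
  obtain ⟨u', x', w', hs', hu', h0', h1', hi', hc'⟩ := h'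
  have hw : w T = w' 0 := h1.trans h0'.symm
  refine ⟨_, _, _, hs.concat hT hT' hs' hw, ?_, ?_, ?_, ?_, ?_⟩
  · filter_upwards [ae_concatAt hu hu'] with τ hτ hmem
    rcases hτ hmem with ⟨h1, h2⟩ | ⟨h1, h2⟩
    · rwa [concatAt_of_lt _ _ h1]
    · rwa [concatAt_of_le _ _ h1.le]
  · rw [concatAt_of_le_of_eq hw hT, h0]
  · rw [concatAt_of_le _ _ (by linarith), add_sub_cancel_left, h1']
  · rw [apply_concatAt₂ ℓ]
    exact intervalIntegrable_concatAt hT hT' hi hi'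
  · rw [apply_concatAt₂ ℓ, integral_concatAt_add hT hT' hi hi']
    exact add_le_add hc hc'

theorem const {x₀ : X} {u₀ : Y} (h : A x₀ + B u₀ = 0) (hu : u₀ ∈ U) :
    CanSteer E A B ℓ U T (T * ℓ u₀ x₀) (E x₀) (E x₀) :=
  ⟨_, _, _, IsIntegralSolution.const T h, ae_of_all _ fun _ _ ↦ hu, rfl, rfl,
    intervalIntegrable_const, by simp⟩

/-- The cost functional `∫ ‖x‖`. -/
abbrev normCost : Y → X → ℝ := fun _ x ↦ ‖x‖

/-- Superposition is compatible with the cost by the triangle inequality. This is why transfers are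
first measured by `∫ ‖x‖` instead of by the bilinear supply rate. -/
theorem add (hT : 0 ≤ T) (hU : ∀ u ∈ U, ∀ u' ∈ U', u + u' ∈ U'')
    (h : CanSteer E A B normCost U T K a b) (h' : CanSteer E A B normCost U' T K' a' b') :
    CanSteer E A B normCost U'' T (K + K') (a + a') (b + b') := by
  obtain ⟨u, x, w, hs, hu, h0, h1, hi, hc⟩ := h
  obtain ⟨u', x', w', hs', hu', h0', h1', hi', hc'⟩ := h'
  have hsum := hs.add hs'
  refine ⟨_, _, _, hsum, ?_, by simp [h0, h0'], by simp [h1, h1'], hsum.state.norm, ?_⟩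
  · filter_upwards [hu, hu'] with t h1 h2 h3
    exact hU _ (h1 h3) _ (h2 h3)
  · refine le_trans ?_ (add_le_add hc hc')
    rw [← intervalIntegral.integral_add hi hi']
    exact intervalIntegral.integral_mono_on hT hsum.state.norm (hi.add hi')
      fun t _ ↦ norm_add_le _ _

theorem smul (r : ℝ) (hU : ∀ u ∈ U, r • u ∈ U') (h : CanSteer E A B normCost U T K a b) :
    CanSteer E A B normCost U' T (|r| * K) (r • a) (r • b) := by
  obtain ⟨u, x, w, hs, hu, h0, h1, hi, hc⟩ := h
  refine ⟨_, _, _, hs.smul r, ?_, by simp [h0], by simp [h1], (hs.smul r).state.norm, ?_⟩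
  · filter_upwards [hu] with t h1 h2
    exact hU _ (h1 h2)
  · simp only [Pi.smul_apply, norm_smul, Real.norm_eq_abs, intervalIntegral.integral_const_mul]
    gcongr

theorem zero (hU : 0 ∈ U) : CanSteer E A B normCost U T 0 0 0 := by
  simpa using const (E := E) (A := A) (B := B) (ℓ := normCost)
    (T := T) (x₀ := 0) (u₀ := 0) (by simp) hU

theorem sum {ι : Type*} (s : Finset ι) (hT : 0 ≤ T) {M k : ι → ℝ} {p q : ι → X}
    (hM : ∀ i ∈ s, 0 ≤ M i)
    (h : ∀ i ∈ s, CanSteer E A B normCost (Metric.closedBall 0 (M i)) T (k i) (p i) (q i)) :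
    CanSteer E A B normCost (Metric.closedBall 0 (∑ i ∈ s, M i)) T (∑ i ∈ s, k i) (∑ i ∈ s, p i)
      (∑ i ∈ s, q i) := by
  classical
  induction s using Finset.induction_on with
  | empty => simpa using zero (by simp)
  | insert i s hi ih =>
    rw [Finset.sum_insert hi, Finset.sum_insert hi, Finset.sum_insert hi, Finset.sum_insert hi]
    refine add hT (fun u hu u' hu' ↦ ?_) (h i (Finset.mem_insert_self i s))
      (ih (fun j hj ↦ hM j (Finset.mem_insert_of_mem hj))
        fun j hj ↦ h j (Finset.mem_insert_of_mem hj))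
    rw [mem_closedBall_zero_iff] at hu hu' ⊢
    exact (norm_add_le _ _).trans (add_le_add hu hu')

end CanSteer

end Transfer

/-! ### Reduction of descriptor systems of index one to ordinary differential equations -/

section Reduction

variable {X Y : Type*} [NormedAddCommGroup X] [NormedSpace ℝ X] [FiniteDimensional ℝ X]
  [NormedAddCommGroup Y] [NormedSpace ℝ Y] [FiniteDimensional ℝ Y]

/-- If `A` maps `ker E` injectively onto a complement of `im E`, then the states compatible with
`d/dt (E x) = A x + B u` depend linearly on `E x` and `u`. -/
theorem exists_state_reconstruction (E A : X →L[ℝ] X) (B : Y →L[ℝ] X)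
    (h : ∀ a, E a = 0 → A a ∈ LinearMap.range (E : X →ₗ[ℝ] X) → a = 0) :
    ∃ (G : X →L[ℝ] X) (K : Y →L[ℝ] X),
      (∀ w ∈ LinearMap.range (E : X →ₗ[ℝ] X), E (G w) = w) ∧
      (∀ w, A (G w) ∈ LinearMap.range (E : X →ₗ[ℝ] X)) ∧
      ∀ x u, A x + B u ∈ LinearMap.range (E : X →ₗ[ℝ] X) → x = G (E x) + K u := by
  set W := LinearMap.range (E : X →ₗ[ℝ] X)
  set N := LinearMap.ker (E : X →ₗ[ℝ] X)
  -- `L` is injective by hypothesis and bijective by rank-nullity. The kernel component `P` of its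
  -- inverse corrects any `f` modulo `A (ker E)` to an element of `im E`.
  let L : N × W →ₗ[ℝ] X := ((A : X →ₗ[ℝ] X) ∘ₗ N.subtype).coprod W.subtype
  have hL : ∀ p, L p = A p.1 + p.2 := fun p ↦ rfl
  have hinj : Function.Injective L := by
    rw [injective_iff_map_eq_zero]
    rintro ⟨a, w⟩ haw
    rw [hL] at haw
    have ha : (a : X) = 0 := h a a.2 (by
      rw [eq_neg_of_add_eq_zero_left haw]
      exact W.neg_mem w.2)
    simp only [ha, map_zero, zero_add] at haw
    exact Prod.ext (Subtype.ext ha) (Subtype.ext haw)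
  have hdim : Module.finrank ℝ (N × W) = Module.finrank ℝ X := by
    rw [Module.finrank_prod, add_comm]
    exact LinearMap.finrank_range_add_finrank_ker (E : X →ₗ[ℝ] X)
  let e := LinearEquiv.ofInjectiveOfFinrankEq L hinj hdim
  let P : X →ₗ[ℝ] X := N.subtype ∘ₗ LinearMap.fst ℝ N W ∘ₗ (e.symm : X →ₗ[ℝ] N × W)
  have hEP : ∀ f, E (P f) = 0 := fun f ↦ ((e.symm f).1).2
  have hAP : ∀ f, f - A (P f) ∈ W := fun f ↦ by
    have h1 : L (e.symm f) = f := e.apply_symm_apply f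
    rw [hL] at h1
    have h2 : f - A (P f) = (e.symm f).2 := by
      rw [sub_eq_iff_eq_add']
      exact h1.symm
    rw [h2]
    exact ((e.symm f).2).2
  obtain ⟨S, hS⟩ := (E : X →ₗ[ℝ] X).rangeRestrict.exists_rightInverse_of_surjective
    (LinearMap.range_rangeRestrict _)
  have hES : ∀ w, E (S w) = w := fun w ↦ congrArg Subtype.val (LinearMap.congr_fun hS w)
  obtain ⟨p, hp⟩ := W.subtype.exists_leftInverse_of_injective W.ker_subtype
  have hpW : ∀ w (hw : w ∈ W), p w = ⟨w, hw⟩ := fun w hw ↦ LinearMap.congr_fun hp ⟨w, hw⟩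
  -- `S` picks a preimage under `E`; subtracting `P (A ·)` stays in the fibre of `E` and moves the
  -- image under `A` into `im E`. The map `p` only extends this linearly from `im E` to `X`.
  let G : X →ₗ[ℝ] X := (S - P ∘ₗ (A : X →ₗ[ℝ] X) ∘ₗ S) ∘ₗ p
  let K : Y →ₗ[ℝ] X := -(P ∘ₗ (B : Y →ₗ[ℝ] X))
  have hG : ∀ w, G w = S (p w) - P (A (S (p w))) := fun w ↦ rfl
  have hK : ∀ u, K u = -P (B u) := fun u ↦ rfl
  have hEG : ∀ w ∈ W, E (G w) = w := fun w hw ↦ by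
    rw [hG, map_sub, hEP, sub_zero, hES, hpW w hw]
  have hAG : ∀ w, A (G w) ∈ W := fun w ↦ by rw [hG, map_sub]; exact hAP _
  refine ⟨LinearMap.toContinuousLinearMap G, LinearMap.toContinuousLinearMap K, hEG, hAG, ?_⟩
  intro x u hA
  have key : x - G (E x) - K u = 0 := by
    refine h _ ?_ ?_
    · rw [map_sub, map_sub, hEG (E x) ⟨x, rfl⟩, hK, map_neg, hEP, neg_zero, sub_self, sub_zero]
    · have h1 : A (x - G (E x) - K u) = (A x + B u) - A (G (E x)) - (B u - A (P (B u))) := by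
        rw [map_sub, map_sub, hK, map_neg]
        abel
      rw [h1]
      exact W.sub_mem (W.sub_mem hA (hAG _)) (hAP _)
  rw [sub_sub, sub_eq_zero] at key
  exact key

end Reduction

section Index

variable {n : ℕ} {E A : Matrix (Fin n) (Fin n) ℝ}

theorem Matrix.map_mulVec_ofReal (M : Matrix (Fin n) (Fin n) ℝ) (v : Fin n → ℝ) :
    M.map (algebraMap ℝ ℂ) *ᵥ (fun i ↦ (v i : ℂ)) = fun i ↦ ((M *ᵥ v) i : ℂ) := by
  ext i
  simp [Matrix.mulVec, dotProduct]

/-- The kernels of the powers stabilize in finite dimension, so the infimum defining the index is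
attained and is not the default value `0` of an empty infimum. Index `0` and index `1` both give
`ker T² ⊆ ker T`. -/
theorem exists_ker_pencilResolvent_eq (hreg : IsRegularPencil E A)
    (hindex : differentiationIndex E A ≤ 1) :
    ∃ μ : ℂ, IsUnit (pencilAt E A μ) ∧
      ∀ v, pencilResolvent E A μ *ᵥ (pencilResolvent E A μ *ᵥ v) = 0 →
        pencilResolvent E A μ *ᵥ v = 0 := by
  have hne : {k : ℕ | ∃ μ : ℂ, μ ≠ 0 ∧ IsUnit (pencilAt E A μ) ∧
      LinearMap.ker ((pencilResolvent E A μ) ^ k).mulVecLin =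
        LinearMap.ker ((pencilResolvent E A μ) ^ (k + 1)).mulVecLin}.Nonempty := by
    obtain ⟨μ, hμ, hu⟩ := hreg
    obtain ⟨k, -, hk⟩ := Module.End.exists_ker_pow_eq_ker_pow_succ
      (Matrix.mulVecLin (pencilResolvent E A μ))
    refine ⟨k, μ, hμ, hu, ?_⟩
    simpa only [← Matrix.toLin'_apply', Matrix.toLin'_pow] using hk
  obtain ⟨μ, -, hu, hker⟩ := Nat.sInf_mem hne
  change LinearMap.ker ((pencilResolvent E A μ) ^ differentiationIndex E A).mulVecLin =
    LinearMap.ker ((pencilResolvent E A μ) ^ (differentiationIndex E A + 1)).mulVecLin at hker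
  refine ⟨μ, hu, fun v hv ↦ ?_⟩
  set T := pencilResolvent E A μ
  generalize differentiationIndex E A = k at hindex hker
  interval_cases k
  · have : T *ᵥ v ∈ LinearMap.ker (T ^ (0 + 1)).mulVecLin := by simpa using hv
    rw [← hker] at this
    simpa using this
  · have : v ∈ LinearMap.ker (T ^ (1 + 1)).mulVecLin := by
      simpa [pow_two, ← Matrix.mulVec_mulVec] using hv
    rw [← hker] at this
    simpa using this

/-- For a regular pencil of index at most one, `A` maps `ker E` injectively onto a complement of
`im E`. -/
theorem eq_zero_of_differentiationIndex_le_one (hreg : IsRegularPencil E A)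
    (hindex : differentiationIndex E A ≤ 1) {a v : Fin n → ℝ} (ha : E *ᵥ a = 0)
    (hav : A *ᵥ a = E *ᵥ v) : a = 0 := by
  obtain ⟨μ, hu, hT⟩ := exists_ker_pencilResolvent_eq hreg hindex
  set a' : Fin n → ℂ := fun i ↦ (a i : ℂ)
  set v' : Fin n → ℂ := fun i ↦ (v i : ℂ)
  have hEa : E.map (algebraMap ℝ ℂ) *ᵥ a' = 0 := by
    rw [Matrix.map_mulVec_ofReal, ha]; ext; simp
  have hAa : A.map (algebraMap ℝ ℂ) *ᵥ a' = E.map (algebraMap ℝ ℂ) *ᵥ v' := by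
    rw [Matrix.map_mulVec_ofReal, Matrix.map_mulVec_ofReal, hav]
  -- This gives `T v' = -a'`, while `E a = 0` gives `T a' = 0`. Hence `T² v' = 0`, and the kernel
  -- condition forces `a' = 0`.
  have hP : pencilAt E A μ *ᵥ a' = -(E.map (algebraMap ℝ ℂ) *ᵥ v') := by
    rw [pencilAt, Matrix.sub_mulVec, Matrix.smul_mulVec, hEa, hAa, smul_zero, zero_sub]
  have hinv : (pencilAt E A μ)⁻¹ * pencilAt E A μ = 1 :=
    Matrix.nonsing_inv_mul _ ((Matrix.isUnit_iff_isUnit_det _).1 hu)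
  have hinv' : pencilAt E A μ * (pencilAt E A μ)⁻¹ = 1 :=
    Matrix.mul_nonsing_inv _ ((Matrix.isUnit_iff_isUnit_det _).1 hu)
  have hTv : pencilResolvent E A μ *ᵥ v' = -a' := by
    rw [pencilResolvent, ← Matrix.mulVec_mulVec, ← neg_eq_iff_eq_neg, ← Matrix.mulVec_neg, ← hP,
      Matrix.mulVec_mulVec, hinv, Matrix.one_mulVec]
  have hTa : pencilResolvent E A μ *ᵥ a' = 0 := by
    rw [pencilResolvent, ← Matrix.mulVec_mulVec, hEa, Matrix.mulVec_zero]
  have hzero := hT v' (by rw [hTv, Matrix.mulVec_neg, hTa, neg_zero])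
  rw [hTv, neg_eq_zero] at hzero
  ext i
  simpa [a'] using congrFun hzero i

end Index

/-! ### Null-controllability with small controls -/

section NullControllable

open CanSteer

variable {X Y : Type*} [NormedAddCommGroup X] [NormedSpace ℝ X]
  [NormedAddCommGroup Y] [NormedSpace ℝ Y]
  {E A : X →L[ℝ] X} {B : Y →L[ℝ] X}

variable (E A B) in
/-- The states in `im E` that can be steered to the origin with essentially bounded controls. -/
def nullControllable : Submodule ℝ X where
  carrier := {z | z ∈ LinearMap.range (E : X →ₗ[ℝ] X) ∧ ∃ T M K, 0 ≤ T ∧ 0 ≤ M ∧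
    CanSteer E A B normCost (Metric.closedBall 0 M) T K z 0}
  zero_mem' := ⟨Submodule.zero_mem _, 0, 0, 0, le_rfl, le_rfl, by simpa using CanSteer.zero (by simp)⟩
  add_mem' := by
    rintro z z' ⟨hz, T, M, K, hT, hM, h⟩ ⟨hz', T', M', K', hT', hM', h'⟩
    have h0 : (0 : Y) ∈ Metric.closedBall (0 : Y) M := by simpa using hM
    have h0' : (0 : Y) ∈ Metric.closedBall (0 : Y) M' := by simpa using hM'
    -- Waiting at the origin, in opposite order of durations, brings both transfers to the common
    -- time `T + T'`.
    have h1 := h.trans hT hT' (CanSteer.zero h0)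
    have h2 := h'.trans hT' hT (CanSteer.zero h0')
    rw [add_comm T' T] at h2
    refine ⟨Submodule.add_mem _ hz hz', T + T', M + M', K + 0 + (K' + 0), by positivity, by positivity, ?_⟩
    have := h1.add (U'' := Metric.closedBall 0 (M + M')) (by positivity) (fun u hu u' hu' ↦ by
      rw [mem_closedBall_zero_iff] at hu hu' ⊢
      exact (norm_add_le _ _).trans (add_le_add hu hu')) h2
    simpa using this
  smul_mem' := by
    rintro c z ⟨hz, T, M, K, hT, hM, h⟩
    refine ⟨Submodule.smul_mem _ c hz, T, |c| * M, |c| * K, hT, by positivity, ?_⟩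
    have := h.smul (U' := Metric.closedBall 0 (|c| * M)) c (fun u hu ↦ by
      rw [mem_closedBall_zero_iff] at hu ⊢
      rw [norm_smul, Real.norm_eq_abs]
      gcongr)
    simpa using this

theorem mem_nullControllable {z : X} :
    z ∈ nullControllable E A B ↔ z ∈ LinearMap.range (E : X →ₗ[ℝ] X) ∧ ∃ T M K, 0 ≤ T ∧ 0 ≤ M ∧
      CanSteer E A B normCost (Metric.closedBall 0 M) T K z 0 := Iff.rfl

theorem CanSteer.zero_extend {M T T' K : ℝ} {a : X} (hT : 0 ≤ T) (hTT' : T ≤ T') (hM : 0 ≤ M)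
    (h : CanSteer E A B normCost (Metric.closedBall 0 M) T K a 0) :
    CanSteer E A B normCost (Metric.closedBall 0 M) T' K a 0 := by
  have h0 : (0 : Y) ∈ Metric.closedBall (0 : Y) M := by simpa using hM
  have := h.trans hT (sub_nonneg.2 hTT') (CanSteer.zero h0)
  simpa using this

/-- Subtracting the constant steady solution moves the target to the origin; the control difference
stays bounded because `U` is. -/
theorem CanSteer.sub_mem_nullControllable {U : Set Y} (hU : Bornology.IsBounded U)
    {x₀ : X} {u₀ : Y} (hsteady : A x₀ + B u₀ = 0) {b : X}
    (hb : b ∈ LinearMap.range (E : X →ₗ[ℝ] X)) {T K : ℝ} (hT : 0 ≤ T)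
    (h : CanSteer E A B normCost U T K b (E x₀)) : b - E x₀ ∈ nullControllable E A B := by
  obtain ⟨M, hM⟩ := hU.exists_norm_le
  have h1 : CanSteer E A B normCost {u₀} T _ (E x₀) (E x₀) := CanSteer.const hsteady rfl
  have h2 := h1.smul (U' := {-u₀}) (-1) (by simp)
  have h3 := h.add (U'' := Metric.closedBall 0 (|M| + ‖u₀‖)) hT (fun u hu u' hu' ↦ by
    rw [mem_singleton_iff.1 hu', mem_closedBall_zero_iff]
    refine (norm_add_le _ _).trans ?_
    rw [norm_neg]
    gcongr
    exact (hM u hu).trans (le_abs_self M)) h2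
  rw [neg_one_smul, add_neg_cancel, ← sub_eq_add_neg] at h3
  exact ⟨Submodule.sub_mem _ hb ⟨x₀, rfl⟩, T, |M| + ‖u₀‖, _, hT, by positivity, h3⟩

/-- Null-controllable states can be steered to the origin within a common time, with controls and
states bounded in terms of the initial value. -/
theorem exists_uniform_steering [FiniteDimensional ℝ X] (E A : X →L[ℝ] X) (B : Y →L[ℝ] X) :
    ∃ T C, 0 ≤ T ∧ 0 ≤ C ∧ ∀ z ∈ nullControllable E A B,
      CanSteer E A B normCost (Metric.closedBall 0 (C * ‖z‖)) T (C * ‖z‖) z 0 := by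
  let b := Module.finBasis ℝ (nullControllable E A B)
  have hb := fun i ↦ (mem_nullControllable.1 (b i).2).2
  choose t M K ht hM hK using hb
  let T := ∑ i, t i
  have hT : 0 ≤ T := Finset.sum_nonneg fun i _ ↦ ht i
  have htT : ∀ i, t i ≤ T := fun i ↦
    Finset.single_le_sum (f := t) (fun j _ ↦ ht j) (Finset.mem_univ i)
  let c := fun i ↦ LinearMap.toContinuousLinearMap (b.coord i)
  let D := ∑ i, ‖c i‖ * (M i + |K i|)
  have hD : 0 ≤ D := Finset.sum_nonneg fun i _ ↦
    mul_nonneg (ContinuousLinearMap.opNorm_nonneg _) (add_nonneg (hM i) (abs_nonneg _))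
  refine ⟨T, D, hT, hD, fun z hz ↦ ?_⟩
  set z' : nullControllable E A B := ⟨z, hz⟩
  have hz' : ‖z'‖ = ‖z‖ := rfl
  have hci : ∀ i, |c i z'| ≤ ‖c i‖ * ‖z‖ := fun i ↦ (c i).le_opNorm z'
  have key := CanSteer.sum (E := E) (A := A) (B := B) Finset.univ hT
    (M := fun i ↦ |c i z'| * M i) (k := fun i ↦ |c i z'| * K i)
    (p := fun i ↦ c i z' • (b i : X)) (q := fun i ↦ 0)
    (fun i _ ↦ mul_nonneg (abs_nonneg _) (hM i)) (fun i _ ↦ by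
      have := ((hK i).zero_extend (ht i) (htT i) (hM i)).smul
        (U' := Metric.closedBall 0 (|c i z'| * M i)) (c i z') (fun u hu ↦ by
          rw [mem_closedBall_zero_iff] at hu ⊢
          rw [norm_smul, Real.norm_eq_abs]
          gcongr)
      simpa using this)
  have hsum : ∑ i, c i z' • (b i : X) = z := by
    have := congrArg (fun y : nullControllable E A B ↦ (y : X)) (b.sum_repr z')
    simpa [c, -Module.Basis.sum_repr] using this
  rw [hsum, Finset.sum_const_zero] at key
  have hbound : ∀ i, |c i z'| * (M i + |K i|) ≤ ‖c i‖ * (M i + |K i|) * ‖z‖ := fun i ↦ by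
    rw [mul_right_comm]
    exact mul_le_mul_of_nonneg_right (hci i) (add_nonneg (hM i) (abs_nonneg _))
  refine key.mono (Metric.closedBall_subset_closedBall ?_) ?_
  · rw [Finset.sum_mul]
    refine Finset.sum_le_sum fun i _ ↦ le_trans ?_ (hbound i)
    gcongr
    linarith [abs_nonneg (K i)]
  · rw [Finset.sum_mul]
    refine Finset.sum_le_sum fun i _ ↦ le_trans ?_ (hbound i)
    gcongr
    linarith [le_abs_self (K i), hM i]

/-! ### The uncontrolled flow on `im E` and local steering to a steady state -/

variable {G : X →L[ℝ] X}

variable (A G) in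
/-- The flow `exp (t A G)` of the uncontrolled system. -/
def homogeneousFlow (t : ℝ) : X →L[ℝ] X := NormedSpace.exp (t • A.comp G)

theorem homogeneousFlow_zero : homogeneousFlow A G 0 = 1 := by
  rw [homogeneousFlow, zero_smul, NormedSpace.exp_zero]

variable [FiniteDimensional ℝ X]

theorem homogeneousFlow_hasDerivAt (t : ℝ) :
    HasDerivAt (homogeneousFlow A G) (A.comp G * homogeneousFlow A G t) t := by
  have : CompleteSpace X := FiniteDimensional.complete ℝ X
  exact hasDerivAt_exp_smul_const' (𝕂 := ℝ) (A.comp G) t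

theorem homogeneousFlow_apply_hasDerivAt (t : ℝ) (z : X) :
    HasDerivAt (fun s ↦ homogeneousFlow A G s z) (A (G (homogeneousFlow A G t z))) t := by
  simpa using (homogeneousFlow_hasDerivAt t).clm_apply (hasDerivAt_const t z)

theorem continuous_homogeneousFlow : Continuous (homogeneousFlow A G) :=
  continuous_iff_continuousAt.2 fun t ↦ by
    have := homogeneousFlow_hasDerivAt (A := A) (G := G) t
    exact this.differentiableAt.continuousAt

theorem homogeneousFlow_neg_apply (t : ℝ) (z : X) :
    homogeneousFlow A G (-t) (homogeneousFlow A G t z) = z := by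
  have : CompleteSpace X := FiniteDimensional.complete ℝ X
  have h : homogeneousFlow A G (-t) * homogeneousFlow A G t = 1 := by
    have hball : ∀ L : X →L[ℝ] X, L ∈ Metric.eball 0
        (NormedSpace.expSeries ℝ (X →L[ℝ] X)).radius := fun L ↦
      (NormedSpace.expSeries_radius_eq_top ℝ (X →L[ℝ] X)).symm ▸ edist_lt_top _ _
    rw [homogeneousFlow, homogeneousFlow, neg_smul, ← NormedSpace.exp_add_of_commute_of_mem_ball
      (𝕂 := ℝ) (Commute.neg_left (Commute.refl _)) (hball _) (hball _), neg_add_cancel,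
      NormedSpace.exp_zero]
  exact DFunLike.congr_fun h z

/-- The component of the flow along a complement of `im E` has zero derivative and vanishes at time
`0`. -/
theorem homogeneousFlow_mem_range (hAG : ∀ w, A (G w) ∈ LinearMap.range (E : X →ₗ[ℝ] X)) (t : ℝ)
    {z : X} (hz : z ∈ LinearMap.range (E : X →ₗ[ℝ] X)) :
    homogeneousFlow A G t z ∈ LinearMap.range (E : X →ₗ[ℝ] X) := by
  have : CompleteSpace X := FiniteDimensional.complete ℝ X
  set W := LinearMap.range (E : X →ₗ[ℝ] X)
  obtain ⟨W', hW'⟩ := W.exists_isCompl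
  let p : X →L[ℝ] X := LinearMap.toContinuousLinearMap (W'.subtype ∘ₗ W'.projectionOnto W hW'.symm)
  have hp : ∀ y, p y = 0 ↔ y ∈ W := fun y ↦ by simp [p]
  have hd : ∀ s, HasDerivAt (fun s ↦ p (homogeneousFlow A G s z)) 0 s := fun s ↦ by
    have := p.hasFDerivAt.comp_hasDerivAt s (homogeneousFlow_apply_hasDerivAt (A := A) (G := G) s z)
    rwa [(hp _).2 (hAG _)] at this
  have hconst := is_const_of_deriv_eq_zero (fun s ↦ (hd s).differentiableAt)
    (fun s ↦ (hd s).deriv) t 0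
  rw [homogeneousFlow_zero] at hconst
  rw [← hp]
  exact hconst.trans ((hp z).2 hz)

/-- Uncontrolled transfers, with cost controlled by the initial value. -/
theorem exists_canSteer_homogeneousFlow
    (hEG : ∀ w ∈ LinearMap.range (E : X →ₗ[ℝ] X), E (G w) = w)
    (hAG : ∀ w, A (G w) ∈ LinearMap.range (E : X →ₗ[ℝ] X)) (B : Y →L[ℝ] X) {T : ℝ} (hT : 0 ≤ T) :
    ∃ C, 0 ≤ C ∧ ∀ z ∈ LinearMap.range (E : X →ₗ[ℝ] X),
      CanSteer E A B normCost {0} T (C * ‖z‖) z (homogeneousFlow A G T z) := by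
  have : CompleteSpace X := FiniteDimensional.complete ℝ X
  have hc : Continuous fun t ↦ homogeneousFlow A G t := continuous_homogeneousFlow
  have hc' : Continuous fun t ↦ ‖G.comp (homogeneousFlow A G t)‖ := by fun_prop
  refine ⟨∫ t in (0 : ℝ)..T, ‖G.comp (homogeneousFlow A G t)‖,
    intervalIntegral.integral_nonneg hT fun _ _ ↦ norm_nonneg _, fun z hz ↦ ?_⟩
  have hx : Continuous fun t ↦ G (homogeneousFlow A G t z) := by fun_prop
  refine ⟨fun _ ↦ 0, fun t ↦ G (homogeneousFlow A G t z), fun t ↦ homogeneousFlow A G t z,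
    IsIntegralSolution.of_hasDerivAt T hx continuous_const
      (fun t ↦ (hEG _ (homogeneousFlow_mem_range hAG t hz)).symm) (fun t ↦ ?_),
    by simp, by simp [homogeneousFlow_zero], rfl, hx.norm.intervalIntegrable _ _, ?_⟩
  · simpa using homogeneousFlow_apply_hasDerivAt t z
  · rw [← intervalIntegral.integral_mul_const]
    exact intervalIntegral.integral_mono_on hT (hx.norm.intervalIntegrable _ _)
      ((hc'.mul continuous_const).intervalIntegrable _ _)
      fun t _ ↦ (G.comp (homogeneousFlow A G t)).le_opNorm z

/-- Drifting for time `T` and then steering to `0` shows that the preimage of the null-controllable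
space under the flow is contained in that space. The flow is invertible, so dimensions agree and the
inclusion is an equality, which yields the forward invariance. -/
theorem homogeneousFlow_mem_nullControllable
    (hEG : ∀ w ∈ LinearMap.range (E : X →ₗ[ℝ] X), E (G w) = w)
    (hAG : ∀ w, A (G w) ∈ LinearMap.range (E : X →ₗ[ℝ] X)) {T : ℝ} (hT : 0 ≤ T)
    {z : X} (hz : z ∈ nullControllable E A B) :
    homogeneousFlow A G T z ∈ nullControllable E A B := by
  obtain ⟨C, -, hC⟩ := exists_canSteer_homogeneousFlow hEG hAG B hT
  let e := LinearEquiv.ofInjectiveEndo (homogeneousFlow A G T : X →ₗ[ℝ] X)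
    (Function.LeftInverse.injective (homogeneousFlow_neg_apply T))
  have hle : (nullControllable E A B).comap (e : X →ₗ[ℝ] X) ≤ nullControllable E A B := by
    rintro y ⟨hr, T', M, K, hT', hM, hy⟩
    have hyr : y ∈ LinearMap.range (E : X →ₗ[ℝ] X) := by
      rw [← homogeneousFlow_neg_apply (A := A) (G := G) T y]
      exact homogeneousFlow_mem_range hAG _ hr
    refine ⟨hyr, T + T', M, C * ‖y‖ + K, by positivity, hM, CanSteer.trans hT hT' ?_ hy⟩
    exact (hC y hyr).mono (by simpa using hM) le_rfl
  have heq : (nullControllable E A B).comap (e : X →ₗ[ℝ] X) = nullControllable E A B := by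
    refine Submodule.eq_of_le_of_finrank_eq hle ?_
    rw [Submodule.comap_equiv_eq_map_symm]
    exact LinearEquiv.finrank_map_eq e.symm _
  rw [← heq] at hz
  exact hz

/-- Near `a`, the time and the cost of steering the system to a steady state with control in the
interior of `U` are bounded. -/
theorem exists_nhds_canSteer (hEG : ∀ w ∈ LinearMap.range (E : X →ₗ[ℝ] X), E (G w) = w)
    (hAG : ∀ w, A (G w) ∈ LinearMap.range (E : X →ₗ[ℝ] X)) {U : Set Y} (hU : Bornology.IsBounded U)
    {x₀ : X} {u₀ : Y} (hsteady : A x₀ + B u₀ = 0) (hu₀ : u₀ ∈ interior U)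
    {a : X} (ha : a ∈ LinearMap.range (E : X →ₗ[ℝ] X)) {T K : ℝ} (hT : 0 ≤ T)
    (h : CanSteer E A B normCost U T K a (E x₀)) :
    ∃ T' K' ε, 0 ≤ T' ∧ 0 < ε ∧ ∀ a' ∈ LinearMap.range (E : X →ₗ[ℝ] X), dist a' a < ε →
      (∃ T'' K'', 0 ≤ T'' ∧ CanSteer E A B normCost U T'' K'' a' (E x₀)) →
      CanSteer E A B normCost U T' K' a' (E x₀) := by
  obtain ⟨C₁, hC₁, hflow⟩ := exists_canSteer_homogeneousFlow hEG hAG B hT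
  obtain ⟨T₁, C, hT₁, hC, hunif⟩ := exists_uniform_steering E A B
  obtain ⟨r, hr, hball⟩ := Metric.isOpen_iff.1 isOpen_interior u₀ hu₀
  set Φ := homogeneousFlow A G T
  -- The second bound on the radius keeps the correcting control smaller than `r`, so that it
  -- remains in `U` when added to `u₀`; the bound `1` caps the extra drift cost by `C₁`.
  refine ⟨T + T₁, K + C₁ + (T₁ * ‖x₀‖ + r), min 1 (r / (C * ‖Φ‖ + 1)), by positivity,
    by positivity, ?_⟩
  rintro a' ha' hdist ⟨T'', K'', hT'', h''⟩
  obtain ⟨δ, hδ⟩ : ∃ δ, δ = a' - a := ⟨_, rfl⟩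
  have hδnorm : ‖δ‖ = dist a' a := by rw [dist_eq_norm, hδ]
  have hδnull : δ ∈ nullControllable E A B := by
    have := Submodule.sub_mem _ (h''.sub_mem_nullControllable hU hsteady ha' hT'')
      (h.sub_mem_nullControllable hU hsteady ha hT)
    rwa [sub_sub_sub_cancel_right, ← hδ] at this
  have hΦδ := homogeneousFlow_mem_nullControllable hEG hAG hT hδnull
  have hsmall : C * ‖Φ δ‖ < r := by
    have h1 : ‖δ‖ < r / (C * ‖Φ‖ + 1) := by
      rw [hδnorm]
      exact hdist.trans_le (min_le_right _ _)
    rw [lt_div_iff₀ (by positivity)] at h1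
    have h2 : C * ‖Φ δ‖ ≤ C * (‖Φ‖ * ‖δ‖) := by
      gcongr
      exact Φ.le_opNorm δ
    nlinarith [norm_nonneg δ]
  -- The control for `a`, applied from `a' = a + δ`, ends at `E x₀ + Φ δ`: the perturbation evolves
  -- without control.
  have step₁ := h.add (U'' := U) hT (fun u hu u' hu' ↦ by
    rw [mem_singleton_iff.1 hu', add_zero]
    exact hu) (hflow δ hδnull.1)
  rw [show a + δ = a' by rw [hδ]; abel] at step₁
  have hst : CanSteer E A B normCost {u₀} T₁ _ (E x₀) (E x₀) := CanSteer.const hsteady rfl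
  -- The error `Φ δ` is steered to `0` on top of the steady solution.
  have step₂ := hst.add (U'' := U) hT₁ (fun u hu u' hu' ↦ by
    rw [mem_singleton_iff.1 hu]
    rw [mem_closedBall_zero_iff] at hu'
    refine interior_subset (hball ?_)
    rw [Metric.mem_ball, dist_eq_norm, add_sub_cancel_left]
    exact hu'.trans_lt hsmall) (hunif _ hΦδ)
  rw [add_zero] at step₂
  refine (step₁.trans hT hT₁ step₂).mono subset_rfl ?_
  have h1 : C₁ * ‖δ‖ ≤ C₁ * 1 := by
    gcongr
    rw [hδnorm]
    exact hdist.le.trans (min_le_left _ _)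
  simp only [normCost]
  linarith

end NullControllable

/-! ### Continuous bounds for the time and cost of reaching a steady state -/

section ContinuousBound

variable {X Y : Type*} [NormedAddCommGroup X] [NormedSpace ℝ X] [FiniteDimensional ℝ X]
  [NormedAddCommGroup Y] [NormedSpace ℝ Y]
  {E A G : X →L[ℝ] X} {B : Y →L[ℝ] X}

open CanSteer

/-- The admissible common bounds for time and cost at a point form an upper set of reals, hence a
convex one. A locally constant choice exists by `exists_nhds_canSteer`, so there is a continuous
selection. -/
theorem exists_continuousOn_steering_bound
    (hEG : ∀ w ∈ LinearMap.range (E : X →ₗ[ℝ] X), E (G w) = w)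
    (hAG : ∀ w, A (G w) ∈ LinearMap.range (E : X →ₗ[ℝ] X)) {U : Set Y} (hU : Bornology.IsBounded U)
    {x₀ : X} {u₀ : Y} (hsteady : A x₀ + B u₀ = 0) (hu₀ : u₀ ∈ interior U) {S : Set X}
    (hSr : ∀ a ∈ S, a ∈ LinearMap.range (E : X →ₗ[ℝ] X))
    (hS : ∀ a ∈ S, ∃ T K, 0 ≤ T ∧ CanSteer E A B normCost U T K a (E x₀)) :
    ∃ g : X → ℝ, ContinuousOn g S ∧
      ∀ a ∈ S, ∃ T, 0 ≤ T ∧ T ≤ g a ∧ CanSteer E A B normCost U T (g a) a (E x₀) := by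
  let t : S → Set ℝ := fun a ↦
    {r | ∃ T, 0 ≤ T ∧ T ≤ r ∧ CanSteer E A B normCost U T r a (E x₀)}
  have ht : ∀ a, Convex ℝ (t a) := fun a ↦ by
    refine OrdConnected.convex (IsUpperSet.ordConnected ?_)
    rintro r r' hr ⟨T, h0, h1, h2⟩
    exact ⟨T, h0, h1.trans hr, h2.mono subset_rfl hr⟩
  obtain ⟨g, hg⟩ := exists_continuous_forall_mem_convex_of_local_const ht (by
    rintro ⟨a, ha⟩
    obtain ⟨T, K, hT, h⟩ := hS a ha
    obtain ⟨T', K', ε, hT', hε, H⟩ :=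
      exists_nhds_canSteer hEG hAG hU hsteady hu₀ (hSr a ha) hT h
    refine ⟨max T' K', ?_⟩
    filter_upwards [Metric.ball_mem_nhds _ hε] with b hb
    exact ⟨T', hT', le_max_left _ _,
      (H b (hSr b b.2) hb (hS b b.2)).mono subset_rfl (le_max_right _ _)⟩)
  classical
  refine ⟨fun a ↦ if ha : a ∈ S then g ⟨a, ha⟩ else 0, ?_, fun a ha ↦ ?_⟩
  · rw [continuousOn_iff_continuous_domRestrict]
    convert g.continuous using 1
    ext a
    simp
  · simp only [dif_pos ha]
    exact hg ⟨a, ha⟩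

end ContinuousBound

/-! ### The energy balance -/

section Energy

variable {X Y : Type*} [NormedAddCommGroup X] [InnerProductSpace ℝ X] [FiniteDimensional ℝ X]
  [NormedAddCommGroup Y] [InnerProductSpace ℝ Y]
  {E A G Q C : X →L[ℝ] X} {B K : Y →L[ℝ] X} {T : ℝ} {u : ℝ → Y} {x w : ℝ → X}

theorem intervalIntegrable_of_continuous_of_bounded [FiniteDimensional ℝ Y] {φ : X → Y → ℝ}
    (hφ : Continuous fun p : X × Y ↦ φ p.1 p.2) (hT : 0 ≤ T)
    (hx : IntervalIntegrable x volume 0 T) (hu : IntervalIntegrable u volume 0 T) {D M : ℝ}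
    (hD : ∀ᵐ t, t ∈ Ioo 0 T → ‖x t‖ ≤ D) (hM : ∀ᵐ t, t ∈ Ioo 0 T → ‖u t‖ ≤ M) :
    IntervalIntegrable (fun t ↦ φ (x t) (u t)) volume 0 T := by
  obtain ⟨c, hc⟩ := ((isCompact_closedBall (0 : X) D).prod
    (isCompact_closedBall (0 : Y) M)).exists_bound_of_continuousOn hφ.continuousOn
  rw [intervalIntegrable_iff_integrableOn_Ioo_of_le hT] at hx hu ⊢
  refine Integrable.mono' (g := fun _ ↦ c) (integrable_const c) ?_ ?_
  · exact hφ.comp_aestronglyMeasurable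
      (hx.aestronglyMeasurable.prodMk hu.aestronglyMeasurable)
  · rw [ae_restrict_iff' measurableSet_Ioo]
    filter_upwards [hD, hM] with t h1 h2 h3
    exact hc (x t, u t) ⟨by simpa using h1 h3, by simpa using h2 h3⟩

namespace IsIntegralSolution

/-- By continuity `w` lies in `im E` throughout the open interval, not just almost everywhere, so
its derivatives do too. This exposes the hidden algebraic constraint on `x` and `u`. -/
theorem ae_velocity_mem_range (hT : 0 ≤ T) (h : IsIntegralSolution E A B T u x w) :
    ∀ᵐ t, t ∈ Ioo 0 T → A (x t) + B (u t) ∈ LinearMap.range (E : X →ₗ[ℝ] X) := by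
  set W := LinearMap.range (E : X →ₗ[ℝ] X)
  obtain ⟨W', hW'⟩ := W.exists_isCompl
  let p : X →L[ℝ] X := LinearMap.toContinuousLinearMap (W'.subtype ∘ₗ W'.projectionOnto W hW'.symm)
  have hp : ∀ y, p y = 0 ↔ y ∈ W := fun y ↦ by simp [p]
  have hcont : ContinuousOn w (Ioo 0 T) := by
    refine (h.absolutelyContinuous hT).continuousOn.mono ?_
    rw [uIcc_of_le hT]
    exact Ioo_subset_Icc_self
  have hzero : EqOn (fun t ↦ p (w t)) (fun _ ↦ 0) (Ioo 0 T) := by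
    refine Measure.eqOn_open_of_ae_eq (μ := volume) ?_ isOpen_Ioo
      (p.continuous.comp_continuousOn hcont) continuousOn_const
    rw [Filter.EventuallyEq, ae_restrict_iff' measurableSet_Ioo]
    filter_upwards [h.representative] with t h1 h2
    rw [hp, h1 h2]
    exact ⟨x t, rfl⟩
  filter_upwards [h.ae_hasDerivAt hT] with t h1 h2
  have h3 := p.hasFDerivAt.comp_hasDerivAt t (h1 h2)
  have h4 : HasDerivAt (p ∘ w) 0 t := (hasDerivAt_const t (0 : X)).congr_of_eventuallyEq (by
    filter_upwards [Ioo_mem_nhds h2.1 h2.2] with s hs using hzero hs)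
  exact (hp _).1 (h3.unique h4)

/-- The state is `G w + K u` almost everywhere, with `w` continuous and `u` bounded. Although states
are only assumed integrable, quadratic expressions in them thus become integrable. -/
theorem exists_state_bound (hT : 0 ≤ T) (h : IsIntegralSolution E A B T u x w)
    (hK : ∀ x u, A x + B u ∈ LinearMap.range (E : X →ₗ[ℝ] X) → x = G (E x) + K u) {M : ℝ}
    (hM : ∀ᵐ t, t ∈ Ioo 0 T → ‖u t‖ ≤ M) : ∃ D, ∀ᵐ t, t ∈ Ioo 0 T → ‖x t‖ ≤ D := by
  obtain ⟨D, hD⟩ := (h.absolutelyContinuous hT).exists_bound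
  refine ⟨‖G‖ * D + ‖K‖ * M, ?_⟩
  filter_upwards [h.ae_velocity_mem_range hT, h.representative, hM] with t h1 h2 h3 h4
  rw [hK _ _ (h1 h4), ← h2 h4]
  refine (norm_add_le _ _).trans (add_le_add ((G.le_opNorm _).trans ?_)
    ((K.le_opNorm _).trans ?_))
  · gcongr
    refine hD t ?_
    rw [uIcc_of_le hT]
    exact Ioo_subset_Icc_self h4
  · gcongr
    exact h3 h4

/-- The energy balance of a port-Hamiltonian descriptor system with Hamiltonian
`w ↦ ⟪Q (G w), w⟫ / 2` on `im E`. -/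
theorem energy_balance (hT : 0 ≤ T) (h : IsIntegralSolution E A B T u x w)
    (hEG : ∀ w ∈ LinearMap.range (E : X →ₗ[ℝ] X), E (G w) = w)
    (hsymm : ∀ x y, inner ℝ (Q x) (E y) = inner ℝ (E x) (Q y))
    (hdiss : ∀ x, inner ℝ (Q x) (A x) = -‖C x‖ ^ 2)
    (hint : IntervalIntegrable (fun t ↦ inner ℝ (Q (x t)) (B (u t)) - ‖C (x t)‖ ^ 2) volume 0 T) :
    inner ℝ (Q (G (w T))) (w T) / 2 = inner ℝ (Q (G (w 0))) (w 0) / 2 +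
      ∫ t in (0 : ℝ)..T, (inner ℝ (Q (x t)) (B (u t)) - ‖C (x t)‖ ^ 2) := by
  have hac := h.absolutelyContinuous hT
  obtain ⟨D, hD⟩ := hac.exists_bound
  let H : X → ℝ := fun w ↦ inner ℝ (Q (G w)) w / 2
  have hH : ContDiff ℝ 1 H :=
    ((Q.contDiff.comp G.contDiff).inner ℝ contDiff_id).div_const 2
  -- The quadratic `H` is Lipschitz on the ball containing the values of `w`, so `H ∘ w` is
  -- absolutely continuous.
  obtain ⟨L, hL⟩ := hH.contDiffOn.exists_lipschitzOnWith (s := Metric.closedBall (0 : X) D)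
    one_ne_zero (convex_closedBall _ _) (isCompact_closedBall _ _)
  have hHac : AbsolutelyContinuousOnInterval (fun t ↦ H (w t)) 0 T :=
    hac.of_dist_le (C := L) fun s hs t ht ↦ hL.dist_le_mul _
      (mem_closedBall_zero_iff.2 (hD s hs)) _ (mem_closedBall_zero_iff.2 (hD t ht))
  refine hHac.eq_add_integral hT hint ?_ ⟨hT, le_rfl⟩
  filter_upwards [h.ae_hasDerivAt hT, h.representative, h.ae_velocity_mem_range hT] with t h1 h2 h3 ht
  have hd := h1 ht
  obtain ⟨ξ, hξ⟩ := h3 ht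
  change E ξ = _ at hξ
  have hderiv := (((Q.comp G).hasFDerivAt.comp_hasDerivAt t hd).inner ℝ hd).div_const 2
  refine hderiv.congr_deriv ?_
  simp only [ContinuousLinearMap.comp_apply]
  -- `G (E v)` and `v` may differ by an element of `ker E`; the symmetry of `Qᵀ E` makes this
  -- invisible when paired with `im E`.
  have hG : ∀ v y, inner ℝ (Q (G (E v))) (E y) = inner ℝ (Q v) (E y) := fun v y ↦ by
    rw [hsymm, hEG (E v) ⟨v, rfl⟩, ← hsymm]
  have e1 : inner ℝ (Q (G (w t))) (A (x t) + B (u t)) =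
      inner ℝ (Q (x t)) (A (x t) + B (u t)) := by
    rw [h2 ht, ← hξ, hG]
  have e2 : inner ℝ (Q (G (A (x t) + B (u t)))) (w t) =
      inner ℝ (Q (x t)) (A (x t) + B (u t)) := by
    rw [h2 ht, ← hξ, hG, hsymm, real_inner_comm]
  have e3 : inner ℝ (Q (x t)) (A (x t) + B (u t)) =
      inner ℝ (Q (x t)) (B (u t)) - ‖C (x t)‖ ^ 2 := by
    rw [inner_add_right, hdiss]
    ring
  simp only [Function.comp_apply, ContinuousLinearMap.comp_apply]
  rw [e1, e2, e3]
  ring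

end IsIntegralSolution

end Energy

/-! ### Distances to kernels and comparison of costs -/

section Aux

variable {X Y Z : Type*} [NormedAddCommGroup X] [NormedSpace ℝ X]
  [NormedAddCommGroup Z] [NormedSpace ℝ Z]
  [NormedAddCommGroup Y] [InnerProductSpace ℝ Y]

theorem CanSteer.innerCost_of_normCost {E A : X →L[ℝ] X} {B : Y →L[ℝ] X} {U : Set Y} {T k : ℝ}
    {a b : X} (hT : 0 ≤ T) (L : X →L[ℝ] Y) {M : ℝ} (hM0 : 0 ≤ M) (hM : ∀ u ∈ U, ‖u‖ ≤ M)
    (h : CanSteer E A B normCost U T k a b) :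
    CanSteer E A B (fun u x ↦ inner ℝ u (L x)) U T (M * ‖L‖ * k) a b := by
  obtain ⟨u, x, w, hs, hu, h0, h1, hi, hc⟩ := h
  have hbound : ∀ᵐ t, t ∈ Ioo 0 T → ‖inner ℝ (u t) (L (x t))‖ ≤ M * ‖L‖ * ‖x t‖ := by
    filter_upwards [hu] with t h1 h2
    refine (norm_inner_le_norm _ _).trans ?_
    rw [mul_assoc]
    exact mul_le_mul (hM _ (h1 h2)) (L.le_opNorm _) (norm_nonneg _) hM0
  have hint : IntervalIntegrable (fun t ↦ inner ℝ (u t) (L (x t))) volume 0 T := by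
    have hx := hs.state.norm.const_mul (M * ‖L‖)
    have hx' := hs.state
    have hu' := hs.control
    rw [intervalIntegrable_iff_integrableOn_Ioo_of_le hT] at hx hx' hu' ⊢
    refine Integrable.mono' hx (hu'.aestronglyMeasurable.inner
      (L.continuous.comp_aestronglyMeasurable hx'.aestronglyMeasurable)) ?_
    rw [ae_restrict_iff' measurableSet_Ioo]
    exact hbound
  refine ⟨u, x, w, hs, hu, h0, h1, hint, ?_⟩
  calc ∫ t in (0 : ℝ)..T, inner ℝ (u t) (L (x t))
      ≤ ∫ t in (0 : ℝ)..T, M * ‖L‖ * ‖x t‖ := by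
        refine intervalIntegral.integral_mono_ae_restrict hT hint
          (hs.state.norm.const_mul _) ?_
        rw [← restrict_Ioo_eq_restrict_Icc, Filter.EventuallyLE, ae_restrict_iff' measurableSet_Ioo]
        filter_upwards [hbound] with t h1 h2
        exact (Real.le_norm_self _).trans (h1 h2)
    _ = M * ‖L‖ * ∫ t in (0 : ℝ)..T, ‖x t‖ := intervalIntegral.integral_const_mul _ _
    _ ≤ M * ‖L‖ * k := by gcongr

variable [FiniteDimensional ℝ X] [FiniteDimensional ℝ Z]

/-- If `P` inverts `L` on its range, then `x - P (L x)` lies in the kernel at distance at most `‖P‖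
‖L x‖` from `x`. -/
theorem exists_infDist_ker_le (L : X →L[ℝ] Z) :
    ∃ c, 0 ≤ c ∧ ∀ x, Metric.infDist x (LinearMap.ker (L : X →ₗ[ℝ] Z)) ≤ c * ‖L x‖ := by
  obtain ⟨S, hS⟩ := (L : X →ₗ[ℝ] Z).rangeRestrict.exists_rightInverse_of_surjective
    (LinearMap.range_rangeRestrict _)
  have hLS : ∀ w, L (S w) = w := fun w ↦ congrArg Subtype.val (LinearMap.congr_fun hS w)
  obtain ⟨p, hp⟩ := (LinearMap.range (L : X →ₗ[ℝ] Z)).subtype.exists_leftInverse_of_injective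
    (Submodule.ker_subtype _)
  let P : Z →L[ℝ] X := LinearMap.toContinuousLinearMap (S ∘ₗ p)
  have hP : ∀ x, L (P (L x)) = L x := fun x ↦ by
    have : p (L x) = ⟨L x, ⟨x, rfl⟩⟩ := LinearMap.congr_fun hp ⟨L x, ⟨x, rfl⟩⟩
    change L (S (p (L x))) = _
    rw [this, hLS]
  refine ⟨‖P‖, norm_nonneg _, fun x ↦ ?_⟩
  have hmem : x - P (L x) ∈ LinearMap.ker (L : X →ₗ[ℝ] Z) := by
    rw [LinearMap.mem_ker]
    change L (x - P (L x)) = 0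
    rw [map_sub, hP, sub_self]
  refine (Metric.infDist_le_dist_of_mem (s := (LinearMap.ker (L : X →ₗ[ℝ] Z) : Set X)) hmem).trans ?_
  rw [dist_eq_norm, sub_sub_cancel]
  exact P.le_opNorm _

end Aux

/-! ### The turnpike property -/

open CanSteer

theorem Matrix.euclideanCLM_mul_apply {k l p : ℕ} (M : Matrix (Fin k) (Fin l) ℝ)
    (N : Matrix (Fin l) (Fin p) ℝ) (x : EuclideanSpace ℝ (Fin p)) :
    (M * N).euclideanCLM x = M.euclideanCLM (N.euclideanCLM x) := by
  ext i
  simp [Matrix.euclideanCLM_apply, Matrix.toLpLin_apply, Matrix.mulVec_mulVec]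

theorem Matrix.inner_euclideanCLM_left {k l : ℕ} (M : Matrix (Fin k) (Fin l) ℝ)
    (x : EuclideanSpace ℝ (Fin l)) (y : EuclideanSpace ℝ (Fin k)) :
    inner ℝ (M.euclideanCLM x) y = inner ℝ x (Mᵀ.euclideanCLM y) := by
  simp only [Matrix.euclideanCLM_apply, Matrix.toLpLin_apply, EuclideanSpace.inner_eq_star_dotProduct,
    star_trivial, Matrix.dotProduct_mulVec, Matrix.vecMul_transpose, dotProduct_comm]

open scoped MatrixOrder Matrix.Norms.L2Operator in
theorem Matrix.PosSemidef.exists_eq_transpose_mul_self {k : ℕ} {M : Matrix (Fin k) (Fin k) ℝ}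
    (hM : M.PosSemidef) : ∃ C : Matrix (Fin k) (Fin k) ℝ, M = Cᵀ * C := by
  obtain ⟨C, hC⟩ := CStarAlgebra.nonneg_iff_eq_star_mul_self.mp hM.nonneg
  rw [Matrix.star_eq_conjTranspose, Matrix.conjTranspose_eq_transpose_of_trivial] at hC
  exact ⟨C, hC⟩

/-! ### Admissible pairs as transfers -/

section Admissible

variable {n m : ℕ} {E A : Matrix (Fin n) (Fin n) ℝ} {B : Matrix (Fin n) (Fin m) ℝ}
  {U : Set (EuclideanSpace ℝ (Fin m))} {T : ℝ} {Ψ : Set (EuclideanSpace ℝ (Fin n))}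
  {a b : EuclideanSpace ℝ (Fin n)}

theorem CanSteer.exists_isAdmissiblePair {ℓ : EuclideanSpace ℝ (Fin m) → EuclideanSpace ℝ (Fin n) → ℝ}
    {k : ℝ} (hT : 0 ≤ T) (hb : b ∈ Ψ)
    (h : CanSteer E.euclideanCLM A.euclideanCLM B.euclideanCLM ℓ U T k a b) :
    ∃ x u, IsAdmissiblePair E A B U T a Ψ x u ∧ ∫ t in (0 : ℝ)..T, ℓ (u t) (x t) ≤ k := by
  obtain ⟨u, x, w, hs, hu, h0, h1, -, hc⟩ := h
  refine ⟨x, u, ⟨?_, w, (isDAESolution_iff_isIntegralSolution hT).2 hs, h0, h1 ▸ hb⟩, hc⟩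
  rwa [ae_restrict_iff' measurableSet_Ioo]

theorem IsAdmissiblePair.exists_canSteer {x : ℝ → EuclideanSpace ℝ (Fin n)}
    {u : ℝ → EuclideanSpace ℝ (Fin m)} (hT : 0 ≤ T) (h : IsAdmissiblePair E A B U T a Ψ x u) :
    ∃ b ∈ Ψ, ∃ k, CanSteer E.euclideanCLM A.euclideanCLM B.euclideanCLM normCost U T k a b := by
  obtain ⟨hu, w, hs, h0, h1⟩ := h
  rw [ae_restrict_iff' measurableSet_Ioo] at hu
  rw [isDAESolution_iff_isIntegralSolution hT] at hs
  exact ⟨w T, h1, _, u, x, w, hs, hu, h0, rfl, hs.state.norm, le_rfl⟩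

theorem mem_controllableTo_iff : a ∈ controllableTo E A B U b ↔
    a ∈ imE E ∧ ∃ T k, 0 ≤ T ∧
      CanSteer E.euclideanCLM A.euclideanCLM B.euclideanCLM normCost U T k a b := by
  simp only [controllableTo, mem_iUnion, controllableAt, mem_ofPred_eq, mem_Ici, exists_prop]
  constructor
  · rintro ⟨T, hT, ha, ⟨rfl, rfl⟩ | ⟨hT', x, u, h⟩⟩
    -- At time `0` the open interval is empty, so the zero state and control are compatible with any
    -- value `a`.
    · refine ⟨ha, 0, 0, le_rfl, fun _ ↦ 0, fun _ ↦ 0, fun _ ↦ a, ⟨?_, ?_, ?_, ?_⟩, ?_⟩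
      all_goals simp
    · obtain ⟨_, rfl, k, hk⟩ := h.exists_canSteer hT
      exact ⟨ha, T, k, hT, hk⟩
  · rintro ⟨ha, T, k, hT, h⟩
    rcases hT.eq_or_lt with rfl | hT'
    · obtain ⟨u, x, w, -, -, h0, h1, -⟩ := h
      exact ⟨0, le_rfl, ha, Or.inl ⟨rfl, h0.symm.trans h1⟩⟩
    · obtain ⟨x, u, hadm, -⟩ := h.exists_isAdmissiblePair hT (mem_singleton b)
      exact ⟨T, hT, ha, Or.inr ⟨hT', x, u, hadm⟩⟩

end Admissible

/-! ### Port-Hamiltonian structure and the comparison trajectory -/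

namespace PHDescriptorSystem

variable {n m : ℕ} (S : PHDescriptorSystem n m)

theorem output_eq (x : EuclideanSpace ℝ (Fin n)) :
    S.output x = (S.Bᵀ * S.Q).euclideanCLM x := rfl

theorem inner_output (u : EuclideanSpace ℝ (Fin m)) (x : EuclideanSpace ℝ (Fin n)) :
    inner ℝ u (S.output x) = inner ℝ (S.Q.euclideanCLM x) (S.B.euclideanCLM u) := by
  rw [output_eq, Matrix.euclideanCLM_mul_apply, ← Matrix.inner_euclideanCLM_left, real_inner_comm]

theorem inner_Q_E (x y : EuclideanSpace ℝ (Fin n)) :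
    inner ℝ (S.Q.euclideanCLM x) (S.E.euclideanCLM y) =
      inner ℝ (S.E.euclideanCLM x) (S.Q.euclideanCLM y) := by
  rw [Matrix.inner_euclideanCLM_left, Matrix.inner_euclideanCLM_left,
    ← Matrix.euclideanCLM_mul_apply, ← Matrix.euclideanCLM_mul_apply, S.QE_symm]

theorem inner_Q_E_nonneg (x : EuclideanSpace ℝ (Fin n)) :
    0 ≤ inner ℝ (S.Q.euclideanCLM x) (S.E.euclideanCLM x) := by
  obtain ⟨C, hC⟩ := S.QE_nonneg.exists_eq_transpose_mul_self
  rw [Matrix.inner_euclideanCLM_left, ← Matrix.euclideanCLM_mul_apply, hC,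
    Matrix.euclideanCLM_mul_apply, ← Matrix.inner_euclideanCLM_left]
  exact real_inner_self_nonneg

/-- The dissipated power is the square of the norm of a linear map with kernel `ker (R Q)`. -/
theorem exists_dissipation : ∃ C : EuclideanSpace ℝ (Fin n) →L[ℝ] EuclideanSpace ℝ (Fin n),
    (∀ x, inner ℝ (S.Q.euclideanCLM x) (S.A.euclideanCLM x) = -‖C x‖ ^ 2) ∧
      LinearMap.ker (S.R * S.Q).toEuclideanLin =
        LinearMap.ker (C : EuclideanSpace ℝ (Fin n) →ₗ[ℝ] EuclideanSpace ℝ (Fin n)) := by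
  obtain ⟨C, hC⟩ := S.R_nonneg.exists_eq_transpose_mul_self
  have hR : ∀ v, inner ℝ v (S.R.euclideanCLM v) = ‖C.euclideanCLM v‖ ^ 2 := fun v ↦ by
    rw [hC, Matrix.euclideanCLM_mul_apply, ← Matrix.inner_euclideanCLM_left,
      real_inner_self_eq_norm_sq]
  have hJ : ∀ v, inner ℝ v (S.J.euclideanCLM v) = 0 := fun v ↦ by
    have h1 : inner ℝ v (S.J.euclideanCLM v) = -inner ℝ v (S.J.euclideanCLM v) := by
      conv_lhs => rw [S.J_skew]
      rw [← real_inner_comm, ← inner_neg_left, Matrix.inner_euclideanCLM_left]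
      simp [Matrix.euclideanCLM_apply]
    linarith
  refine ⟨(C * S.Q).euclideanCLM, fun x ↦ ?_, ?_⟩
  · have h1 : S.A.euclideanCLM x = S.J.euclideanCLM (S.Q.euclideanCLM x) -
        S.R.euclideanCLM (S.Q.euclideanCLM x) := by
      rw [A, Matrix.euclideanCLM_mul_apply]
      simp [Matrix.euclideanCLM_apply]
    rw [h1, inner_sub_right, hJ, hR, Matrix.euclideanCLM_mul_apply, zero_sub]
  · ext x
    change (S.R * S.Q).euclideanCLM x = 0 ↔ (C * S.Q).euclideanCLM x = 0
    rw [Matrix.euclideanCLM_mul_apply, Matrix.euclideanCLM_mul_apply]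
    constructor
    · intro h
      have := hR (S.Q.euclideanCLM x)
      rw [h, inner_zero_right, eq_comm, sq_eq_zero_iff, norm_eq_zero] at this
      exact this
    · intro h
      rw [hC, Matrix.euclideanCLM_mul_apply, h, map_zero]

/-- The origin with zero control is a competing steady state with zero supply. -/
theorem optimal_steady_state_cost_nonpos {U : Set (EuclideanSpace ℝ (Fin m))} (hU0 : 0 ∈ U)
    {w : EuclideanSpace ℝ (Fin n)} {u : EuclideanSpace ℝ (Fin m)}
    (h : S.IsOptimalSteadyState U w u) : ∃ x, u ∈ U ∧ S.E.euclideanCLM x = w ∧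
      S.A.euclideanCLM x + S.B.euclideanCLM u = 0 ∧ inner ℝ u (S.output x) ≤ 0 := by
  obtain ⟨x, ⟨hu, hw, hx⟩, hmin⟩ := h
  refine ⟨x, hu, hw, hx, ?_⟩
  simpa using hmin 0 0 0 ⟨hU0, by simp, by simp⟩

/-- The competitor goes to the steady state, rests for `T - T₁ - T₂` at nonpositive cost, and then
moves to `ψ`; the bound is therefore independent of `T`. -/
theorem IsOptimalPair.suppliedEnergy_le {U : Set (EuclideanSpace ℝ (Fin m))}
    {Ψ : Set (EuclideanSpace ℝ (Fin n))} {T T₁ T₂ k₁ k₂ M : ℝ} {a x₀ ψ : EuclideanSpace ℝ (Fin n)}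
    {u₀ : EuclideanSpace ℝ (Fin m)} {x : ℝ → EuclideanSpace ℝ (Fin n)}
    {u : ℝ → EuclideanSpace ℝ (Fin m)} (hxu : S.IsOptimalPair U Ψ T a x u)
    (hM0 : 0 ≤ M) (hM : ∀ u ∈ U, ‖u‖ ≤ M) (hu₀ : u₀ ∈ U)
    (hsteady : S.A.euclideanCLM x₀ + S.B.euclideanCLM u₀ = 0)
    (hcost : inner ℝ u₀ (S.output x₀) ≤ 0) (hT₁ : 0 ≤ T₁) (hT₂ : 0 ≤ T₂) (hT : T₁ + T₂ ≤ T)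
    (h₁ : CanSteer S.E.euclideanCLM S.A.euclideanCLM S.B.euclideanCLM normCost U T₁ k₁ a
      (S.E.euclideanCLM x₀))
    (hψ : ψ ∈ Ψ)
    (h₂ : CanSteer S.E.euclideanCLM S.A.euclideanCLM S.B.euclideanCLM normCost U T₂ k₂
      (S.E.euclideanCLM x₀) ψ) :
    S.suppliedEnergy T x u ≤ M * ‖(S.Bᵀ * S.Q).euclideanCLM‖ * (k₁ + k₂) := by
  have hs : 0 ≤ T - T₁ - T₂ := by linarith
  have st₁ := h₁.innerCost_of_normCost hT₁ (S.Bᵀ * S.Q).euclideanCLM hM0 hM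
  have st₂ := CanSteer.const (E := S.E.euclideanCLM) (T := T - T₁ - T₂)
    (ℓ := fun u x ↦ inner ℝ u ((S.Bᵀ * S.Q).euclideanCLM x)) hsteady hu₀
  have st₃ := h₂.innerCost_of_normCost hT₂ (S.Bᵀ * S.Q).euclideanCLM hM0 hM
  have st := (st₁.trans hT₁ hs st₂).trans (add_nonneg hT₁ hs) hT₂ st₃
  rw [show T₁ + (T - T₁ - T₂) + T₂ = T by ring] at st
  obtain ⟨x', u', hadm, hle⟩ := st.exists_isAdmissiblePair (by linarith) hψ
  refine (hxu.2 x' u' hadm).trans (hle.trans ?_)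
  have h1 : (T - T₁ - T₂) * inner ℝ u₀ ((S.Bᵀ * S.Q).euclideanCLM x₀) ≤ 0 :=
    mul_nonpos_of_nonneg_of_nonpos hs hcost
  linarith

theorem exists_linear_state_reconstruction (hreg : IsRegularPencil S.E S.A)
    (hindex : differentiationIndex S.E S.A ≤ 1) :
    ∃ (G : EuclideanSpace ℝ (Fin n) →L[ℝ] EuclideanSpace ℝ (Fin n))
      (K : EuclideanSpace ℝ (Fin m) →L[ℝ] EuclideanSpace ℝ (Fin n)),
      (∀ w ∈ imE S.E, S.E.euclideanCLM (G w) = w) ∧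
      (∀ w, S.A.euclideanCLM (G w) ∈ imE S.E) ∧
      ∀ x u, S.A.euclideanCLM x + S.B.euclideanCLM u ∈ imE S.E →
        x = G (S.E.euclideanCLM x) + K u := by
  refine exists_state_reconstruction S.E.euclideanCLM S.A.euclideanCLM
    S.B.euclideanCLM (fun a ha hav ↦ ?_)
  obtain ⟨v, hv⟩ := hav
  have := eq_zero_of_differentiationIndex_le_one hreg hindex (a := a.ofLp) (v := v.ofLp)
    (congrArg WithLp.ofLp ha) (congrArg WithLp.ofLp hv.symm)
  ext i
  exact congrFun this i

/-- Along optimal pairs, the dissipation integral is bounded by the supplied energy and the initial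
value of the Hamiltonian. -/
theorem IsOptimalPair.integral_infDist_sq_le {U : Set (EuclideanSpace ℝ (Fin m))}
    {Ψ : Set (EuclideanSpace ℝ (Fin n))} {T M c : ℝ} {a : EuclideanSpace ℝ (Fin n)}
    {x : ℝ → EuclideanSpace ℝ (Fin n)} {u : ℝ → EuclideanSpace ℝ (Fin m)}
    {G C : EuclideanSpace ℝ (Fin n) →L[ℝ] EuclideanSpace ℝ (Fin n)}
    {K : EuclideanSpace ℝ (Fin m) →L[ℝ] EuclideanSpace ℝ (Fin n)}
    {V : Submodule ℝ (EuclideanSpace ℝ (Fin n))}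
    (hxu : S.IsOptimalPair U Ψ T a x u) (hT : 0 ≤ T) (hM : ∀ u ∈ U, ‖u‖ ≤ M)
    (hΨ : Ψ ⊆ (imE S.E : Set (EuclideanSpace ℝ (Fin n))))
    (hEG : ∀ w ∈ imE S.E, S.E.euclideanCLM (G w) = w)
    (hrec : ∀ x u, S.A.euclideanCLM x + S.B.euclideanCLM u ∈ imE S.E →
      x = G (S.E.euclideanCLM x) + K u)
    (hdiss : ∀ x, inner ℝ (S.Q.euclideanCLM x) (S.A.euclideanCLM x) = -‖C x‖ ^ 2)
    (hdist : ∀ x, Metric.infDist x V ≤ c * ‖C x‖) :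
    IntervalIntegrable (fun t ↦ Metric.infDist (x t) V ^ 2) volume 0 T ∧
      ∫ t in (0 : ℝ)..T, Metric.infDist (x t) V ^ 2 ≤
        c ^ 2 * (S.suppliedEnergy T x u + inner ℝ (S.Q.euclideanCLM (G a)) a / 2) := by
  obtain ⟨huU, w, hsol, hw0, hwT⟩ := hxu.1
  rw [ae_restrict_iff' measurableSet_Ioo] at huU
  rw [isDAESolution_iff_isIntegralSolution hT] at hsol
  have huM : ∀ᵐ t, t ∈ Ioo 0 T → ‖u t‖ ≤ M := huU.mono fun t h1 h2 ↦ hM _ (h1 h2)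
  obtain ⟨D, hD⟩ := hsol.exists_state_bound hT hrec huM
  have hi₁ : IntervalIntegrable
      (fun t ↦ inner ℝ (S.Q.euclideanCLM (x t)) (S.B.euclideanCLM (u t))) volume 0 T :=
    intervalIntegrable_of_continuous_of_bounded
      (φ := fun x u ↦ inner ℝ (S.Q.euclideanCLM x) (S.B.euclideanCLM u))
      (by fun_prop) hT hsol.state hsol.control hD huM
  have hi₂ : IntervalIntegrable (fun t ↦ ‖C (x t)‖ ^ 2) volume 0 T :=
    intervalIntegrable_of_continuous_of_bounded (φ := fun x _ ↦ ‖C x‖ ^ 2)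
      (by fun_prop) hT hsol.state hsol.control hD huM
  have hi₃ : IntervalIntegrable (fun t ↦ Metric.infDist (x t) V ^ 2) volume 0 T := by
    have hc := Metric.continuous_infDist_pt (V : Set (EuclideanSpace ℝ (Fin n)))
    exact intervalIntegrable_of_continuous_of_bounded
      (φ := fun x _ ↦ Metric.infDist x (V : Set (EuclideanSpace ℝ (Fin n))) ^ 2)
      (by fun_prop) hT hsol.state hsol.control hD huM
  refine ⟨hi₃, ?_⟩
  have hbal := hsol.energy_balance hT hEG S.inner_Q_E hdiss (hi₁.sub hi₂)
  rw [intervalIntegral.integral_sub hi₁ hi₂, hw0] at hbal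
  -- The terminal stored energy can be dropped; its sign uses `w T ∈ im E`, which comes from the
  -- terminal constraint.
  have hHT : 0 ≤ inner ℝ (S.Q.euclideanCLM (G (w T))) (w T) := by
    have h1 := S.inner_Q_E_nonneg (G (w T))
    rwa [hEG _ (hΨ hwT)] at h1
  have hsup : S.suppliedEnergy T x u =
      ∫ t in (0 : ℝ)..T, inner ℝ (S.Q.euclideanCLM (x t)) (S.B.euclideanCLM (u t)) := by
    simp only [suppliedEnergy, inner_output]
  calc ∫ t in (0 : ℝ)..T, Metric.infDist (x t) V ^ 2
      ≤ ∫ t in (0 : ℝ)..T, c ^ 2 * ‖C (x t)‖ ^ 2 := by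
        refine intervalIntegral.integral_mono_on hT hi₃ (hi₂.const_mul _) fun t _ ↦ ?_
        rw [← mul_pow]
        exact pow_le_pow_left₀ Metric.infDist_nonneg (hdist (x t)) 2
    _ = c ^ 2 * ∫ t in (0 : ℝ)..T, ‖C (x t)‖ ^ 2 := intervalIntegral.integral_const_mul _ _
    _ ≤ _ := by
        gcongr
        rw [hsup]
        linarith

end PHDescriptorSystem

end

theorem mainTheorem1 {n m : ℕ} (S : PHDescriptorSystem n m)
    (hreg : IsRegularPencil S.E S.A) (hindex : differentiationIndex S.E S.A ≤ 1)
    (U : Set (EuclideanSpace ℝ (Fin m))) (hUconv : Convex ℝ U) (hUcomp : IsCompact U)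
    (hU0 : (0 : EuclideanSpace ℝ (Fin m)) ∈ interior U)
    (Ψ : Set (EuclideanSpace ℝ (Fin n))) (hΨclosed : IsClosed Ψ)
    (hΨ : Ψ ⊆ (imE S.E : Set (EuclideanSpace ℝ (Fin n))))
    (wbar : EuclideanSpace ℝ (Fin n)) (ubar : EuclideanSpace ℝ (Fin m))
    (hopt : S.IsOptimalSteadyState U wbar ubar) (hubar : ubar ∈ interior U)
    (hreach : wbar ∈ controllableToSet S.E S.A S.B U Ψ) :
    S.HasStateIntegralTurnpike U Ψ (controllableTo S.E S.A S.B U wbar)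
      (LinearMap.ker (S.R * S.Q).toEuclideanLin) := by
  have h0U : (0 : EuclideanSpace ℝ (Fin m)) ∈ U := interior_subset hU0
  obtain ⟨xbar, hubarU, rfl, hsteady, hcost⟩ := S.optimal_steady_state_cost_nonpos h0U hopt
  obtain ⟨ψ, hψ, hwψ⟩ : ∃ ψ ∈ Ψ, S.E.euclideanCLM xbar ∈ controllableTo S.E S.A S.B U ψ := by
    simpa only [controllableToSet, mem_iUnion₂, exists_prop] using hreach
  obtain ⟨-, T₂, K₂, hT₂, hsteer₂⟩ := mem_controllableTo_iff.1 hwψ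
  refine ⟨fun a ha ↦ ?_, ?_⟩
  · obtain ⟨hr, T, k, hT, h⟩ := mem_controllableTo_iff.1 ha
    exact mem_biUnion hψ (mem_controllableTo_iff.2
      ⟨hr, _, _, add_nonneg hT hT₂, h.trans hT hT₂ hsteer₂⟩)
  obtain ⟨G, K, hEG, hAG, hrec⟩ := S.exists_linear_state_reconstruction hreg hindex
  obtain ⟨g, hgcont, hg⟩ := exists_continuousOn_steering_bound
    (E := S.E.euclideanCLM) (A := S.A.euclideanCLM) (B := S.B.euclideanCLM) (G := G)
    hEG hAG hUcomp.isBounded hsteady hubar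
    (S := controllableTo S.E S.A S.B U (S.E.euclideanCLM xbar))
    (fun a ha ↦ (mem_controllableTo_iff.1 ha).1)
    (fun a ha ↦ (mem_controllableTo_iff.1 ha).2)
  obtain ⟨C, hdiss, hker⟩ := S.exists_dissipation
  obtain ⟨c, -, hdist⟩ := exists_infDist_ker_le C
  rw [← hker] at hdist
  obtain ⟨M, hM⟩ := hUcomp.isBounded.exists_norm_le
  have hM0 : 0 ≤ M := (norm_nonneg _).trans (hM 0 h0U)
  have hH : ∀ w ∈ imE S.E, 0 ≤ inner ℝ (S.Q.euclideanCLM (G w)) w := fun w hw ↦ by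
    have h1 := S.inner_Q_E_nonneg (G w)
    rwa [hEG w hw] at h1
  have hHc : Continuous fun w ↦ inner ℝ (S.Q.euclideanCLM (G w)) w := by fun_prop
  have hstp : ∀ a ∈ controllableTo S.E S.A S.B U (S.E.euclideanCLM xbar), a ∈ imE S.E ∧ 0 ≤ g a :=
    fun a ha ↦ by
      obtain ⟨T, h0, h1, -⟩ := hg a ha
      exact ⟨(mem_controllableTo_iff.1 ha).1, h0.trans h1⟩
  -- In the bound `F`, `g a` estimates the cost of the arrival and `|K₂|` that of the departure,
  -- followed by the initial stored energy. The same `g` bounds the arrival time, so `g + T₂` can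
  -- serve as `T₀`.
  have hFcont : ContinuousOn (fun a ↦ c ^ 2 * (M * ‖(S.Bᵀ * S.Q).euclideanCLM‖ * (g a + |K₂|) +
      inner ℝ (S.Q.euclideanCLM (G a)) a / 2))
      (controllableTo S.E S.A S.B U (S.E.euclideanCLM xbar)) := by
    have := hHc.continuousOn (s := controllableTo S.E S.A S.B U (S.E.euclideanCLM xbar))
    fun_prop
  refine ⟨_, fun a ↦ g a + T₂, hFcont, hgcont.add continuousOn_const, fun a ha ↦ ?_,
    fun a ha T hT x u hxu ↦ ?_⟩
  · obtain ⟨hr, hga⟩ := hstp a ha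
    have := hH a hr
    exact ⟨by positivity, by positivity⟩
  · obtain ⟨hr, hga⟩ := hstp a ha
    obtain ⟨T₁, hT₁, hT₁g, hsteer₁⟩ := hg a ha
    have hT' : T₁ + T₂ ≤ T := (add_le_add_left hT₁g T₂).trans hT.le
    have hcomp := PHDescriptorSystem.IsOptimalPair.suppliedEnergy_le S hxu hM0 hM hubarU hsteady hcost hT₁ hT₂ hT'
      hsteer₁ hψ (hsteer₂.mono subset_rfl (le_abs_self K₂))
    obtain ⟨h1, h2⟩ := PHDescriptorSystem.IsOptimalPair.integral_infDist_sq_le S hxu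
      ((add_nonneg hT₁ hT₂).trans hT') hM hΨ hEG hrec hdiss hdist
    exact ⟨h1, h2.trans (by gcongr)⟩
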